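/- Let $\gamma>0$, $\lambda>0$, $\mu>0$. Let $Q=H^1(\mathbb R^+)\oplus H^1(\mathbb R^-)$ be the space of all $\psi\in L^2(\mathbb R)$ (complex valued) having a weak derivative $\psi'\in L^2$ on $\mathbb R\setminus\{0\}$, with norm $\|\psi\|_Q^2=\|\psi\|^2+\|\psi'\|^2$, where $\|\cdot\|$ is the norm of $L^2(\mathbb R)$ and $\|\cdot\|_p$ that of $L^p(\mathbb R)$; write $\psi(0\pm)$ for the one-sided boundary values at $0$ of $\psi\in Q$. Let $H_\gamma$ be the self-adjoint operator in $L^2(\mathbb R)$ given by $$D(H_\gamma)=\{\psi\in H^2(\mathbb R\setminus\{0\}) : \psi'(0+)=\psi'(0-),\ \psi(0+)-\psi(0-)=-\gamma\,\psi'(0+)\},\qquad H_\gamma\psi=-\psi''\ \text{ on } \mathbb R\setminus\{0\},$$ and let $e^{-iH_\gamma t}$, $t\in\mathbb R$, be the unitary group that it generates. For $\psi\in Q$ let $$E(\psi)=\frac12\|\psi'\|^2-\frac1{2\gamma}|\psi(0+)-\psi(0-)|^2-\frac{\lambda}{2\mu+2}\|\psi\|_{2\mu+2}^{2\mu+2}.$$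 **Proposition.** Let $0<T\le+\infty$, $\psi_0\in Q$, and let $\psi\in C^0([0,T),Q)$ be a solution with $\psi(0)=\psi_0$ of $$\psi(t)=e^{-iH_\gamma t}\psi_0+i\lambda\int_0^t e^{-iH_\gamma(t-s)}|\psi(s)|^{2\mu}\psi(s)\,ds,\qquad t\in[0,T).$$ Then, for every $t\in[0,T)$, $$\|\psi(t)\|=\|\psi_0\|\qquad\text{and}\qquad E(\psi(t))=E(\psi_0).$$ -/

import Mathlib

open MeasureTheory Filter Topology
open scoped ContDiff

noncomputable section

namespace DeltaPrime

/-- The complex Hilbert space `L²(ℝ)`. -/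
abbrev L2 : Type := Lp ℂ 2 (volume : Measure ℝ)

/-- `g ∈ L²(ℝ)` is the weak derivative of `f ∈ L²(ℝ)` on `ℝ \ {0}`: the test functions are the
smooth functions with compact support contained in `ℝ \ {0}`, so no condition links the two
half-lines. -/
def HasWeakDeriv (f g : L2) : Prop :=
  ∀ φ : ℝ → ℝ, ContDiff ℝ ∞ φ → HasCompactSupport φ → tsupport φ ⊆ {0}ᶜ →
    ∫ x, deriv φ x • f x = -∫ x, φ x • g x

theorem integrable_test_smul (f : L2) {φ : ℝ → ℝ} (hφ : Continuous φ) (hc : HasCompactSupport φ) :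
    Integrable (fun x => φ x • f x) :=
  (((Lp.memLp f).locallyIntegrable one_le_two).integrable_smul_left_of_hasCompactSupport hφ hc)

theorem HasWeakDeriv.zero : HasWeakDeriv 0 0 := by
  intro φ _ _ _
  have h : (fun x : ℝ => (0 : L2) x) =ᵐ[volume] fun _ => (0 : ℂ) := Lp.coeFn_zero ℂ 2 volume
  have h1 : ∫ x, deriv φ x • (0 : L2) x = ∫ _ : ℝ, (0 : ℂ) :=
    integral_congr_ae (h.mono fun x hx => by simp only at hx ⊢; rw [hx, smul_zero])
  have h2 : ∫ x, φ x • (0 : L2) x = ∫ _ : ℝ, (0 : ℂ) :=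
    integral_congr_ae (h.mono fun x hx => by simp only at hx ⊢; rw [hx, smul_zero])
  rw [h1, h2]; simp

theorem HasWeakDeriv.add {f₁ g₁ f₂ g₂ : L2} (h₁ : HasWeakDeriv f₁ g₁) (h₂ : HasWeakDeriv f₂ g₂) :
    HasWeakDeriv (f₁ + f₂) (g₁ + g₂) := by
  intro φ hφ hc hs
  have key : ∀ (a b : L2) (θ : ℝ → ℝ), Continuous θ → HasCompactSupport θ →
      ∫ x, θ x • (a + b : L2) x = (∫ x, θ x • a x) + ∫ x, θ x • b x := by
    intro a b θ hθ hθc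
    rw [← integral_add (integrable_test_smul a hθ hθc) (integrable_test_smul b hθ hθc)]
    refine integral_congr_ae ((Lp.coeFn_add a b).mono fun x hx => ?_)
    simp only at hx ⊢
    rw [hx, Pi.add_apply, smul_add]
  rw [key _ _ _ (hφ.continuous_deriv (by simp)) hc.deriv, key _ _ _ hφ.continuous hc,
    h₁ φ hφ hc hs, h₂ φ hφ hc hs, neg_add]

theorem HasWeakDeriv.smul (c : ℂ) {f g : L2} (h : HasWeakDeriv f g) :
    HasWeakDeriv (c • f) (c • g) := by
  intro φ hφ hc hs
  have key : ∀ (a : L2) (θ : ℝ → ℝ), ∫ x, θ x • (c • a : L2) x = c • ∫ x, θ x • a x := by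
    intro a θ
    rw [← integral_smul]
    refine integral_congr_ae ((Lp.coeFn_smul c a).mono fun x hx => ?_)
    simp only at hx ⊢
    rw [hx, Pi.smul_apply, smul_comm]
  rw [key, key, h φ hφ hc hs, smul_neg]

theorem HasWeakDeriv.eq_zero {g : L2} (h : HasWeakDeriv 0 g) : g = 0 := by
  have h0 : ∀ᵐ x : ℝ, x ∈ ({0}ᶜ : Set ℝ) → g x = 0 := by
    refine isOpen_compl_singleton.ae_eq_zero_of_integral_contDiff_smul_eq_zero
      (((Lp.memLp g).locallyIntegrable one_le_two).locallyIntegrableOn _) ?_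
    intro φ hφ hc hs
    have h1 := h φ hφ hc hs
    have h2 : ∫ x, deriv φ x • (0 : L2) x = ∫ _ : ℝ, (0 : ℂ) :=
      integral_congr_ae ((Lp.coeFn_zero ℂ 2 (volume : Measure ℝ)).mono fun x hx => by
        simp only at hx ⊢; rw [hx]; simp)
    rw [h2, integral_zero] at h1
    exact neg_eq_zero.mp h1.symm
  rw [Lp.eq_zero_iff_ae_eq_zero]
  filter_upwards [h0, Measure.ae_ne volume (0 : ℝ)] with x hx hx0
  exact hx hx0

/-- The energy space `Q = H¹(ℝ⁺) ⊕ H¹(ℝ⁻)`: functions `ψ ∈ L²(ℝ)` having a weak derivative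
`ψ' ∈ L²` on `ℝ \ {0}`. An element is stored as the pair `(ψ, ψ')` (the second entry is
determined by the first), and the norm inherited from the `ℓ²` product `L² × L²` is
`‖ψ‖_Q² = ‖ψ‖² + ‖ψ'‖²`. -/
def energySpace : Submodule ℂ (WithLp 2 (L2 × L2)) where
  carrier := {p | HasWeakDeriv p.fst p.snd}
  add_mem' ha hb := HasWeakDeriv.add ha hb
  zero_mem' := HasWeakDeriv.zero
  smul_mem' c _ h := HasWeakDeriv.smul c h

/-- The type of elements of the energy space. -/
abbrev Q : Type := energySpace

/-- The underlying `L²` function `ψ` of an element of `Q`. -/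
def Q.fn (ψ : Q) : L2 := ψ.1.fst

/-- The weak derivative `ψ'` (away from the origin) of an element of `Q`. -/
def Q.der (ψ : Q) : L2 := ψ.1.snd

/-- The filter of right neighbourhoods of `0`, up to null sets. -/
def rightZero : Filter ℝ := 𝓝[>] 0 ⊓ ae volume

/-- The filter of left neighbourhoods of `0`, up to null sets. -/
def leftZero : Filter ℝ := 𝓝[<] 0 ⊓ ae volume

/-- `f(0+)`: the essential limit of `f` at `0` from the right. For `f ∈ H¹(ℝ⁺)` it exists and is
the limit at `0+` of the continuous representative. -/
def rightTrace (f : L2) : ℂ := limUnder rightZero (fun x => f x)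

/-- `f(0-)`: the essential limit of `f` at `0` from the left. -/
def leftTrace (f : L2) : ℂ := limUnder leftZero (fun x => f x)

/-- The graph of the `δ'` Hamiltonian: the pairs `(ψ, -ψ'')` with `ψ ∈ H²(ℝ \ {0})`,
`ψ'(0+) = ψ'(0-)` and `ψ(0+) - ψ(0-) = -γ ψ'(0+)`. Here `ψ₁ = ψ'`, `ψ₂ = ψ''`, and `a`, `b`, `d`
are the one-sided boundary values `ψ(0+)`, `ψ(0-)`, `ψ'(0+) = ψ'(0-)`. -/
def hamiltonianGraph (γ : ℝ) : Submodule ℂ (L2 × L2) where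
  carrier := {p | ∃ ψ₁ ψ₂ : L2, HasWeakDeriv p.1 ψ₁ ∧ HasWeakDeriv ψ₁ ψ₂ ∧ p.2 = -ψ₂ ∧
    ∃ a b d : ℂ, Tendsto (fun x => p.1 x) rightZero (𝓝 a) ∧
      Tendsto (fun x => p.1 x) leftZero (𝓝 b) ∧
      Tendsto (fun x => ψ₁ x) rightZero (𝓝 d) ∧
      Tendsto (fun x => ψ₁ x) leftZero (𝓝 d) ∧
      a - b = -(γ : ℂ) * d}
  add_mem' := by
    rintro ⟨u, v⟩ ⟨u', v'⟩ ⟨ψ₁, ψ₂, h1, h2, h3, a, b, d, ha, hb, hd, he, hf⟩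
      ⟨ψ₁', ψ₂', h1', h2', h3', a', b', d', ha', hb', hd', he', hf'⟩
    have key : ∀ (l : Filter ℝ), l ≤ ae volume → ∀ (f g : L2) (p q : ℂ),
        Tendsto (fun x => f x) l (𝓝 p) → Tendsto (fun x => g x) l (𝓝 q) →
        Tendsto (fun x => (f + g : L2) x) l (𝓝 (p + q)) := by
      intro l hl f g p q hp hq
      refine (hp.add hq).congr' ?_
      exact hl ((Lp.coeFn_add f g).mono fun x hx => hx.symm)
    have hr : rightZero ≤ ae volume := inf_le_right
    have hl : leftZero ≤ ae volume := inf_le_right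
    refine ⟨ψ₁ + ψ₁', ψ₂ + ψ₂', h1.add h1', h2.add h2', ?_, a + a', b + b', d + d',
      key _ hr _ _ _ _ ha ha', key _ hl _ _ _ _ hb hb', key _ hr _ _ _ _ hd hd',
      key _ hl _ _ _ _ he he', ?_⟩
    · simp only at h3 h3' ⊢
      rw [Prod.snd_add, h3, h3']; simp only; abel
    · linear_combination hf + hf'
  zero_mem' := by
    have key : ∀ (l : Filter ℝ), l ≤ ae volume → Tendsto (fun x => (0 : L2) x) l (𝓝 0) := by
      intro l hl
      refine tendsto_const_nhds.congr' ?_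
      exact hl ((Lp.coeFn_zero ℂ 2 (volume : Measure ℝ)).mono fun x hx => hx.symm)
    have hr : rightZero ≤ ae volume := inf_le_right
    have hl : leftZero ≤ ae volume := inf_le_right
    exact ⟨0, 0, HasWeakDeriv.zero, HasWeakDeriv.zero, by simp, 0, 0, 0, key _ hr, key _ hl,
      key _ hr, key _ hl, by simp⟩
  smul_mem' := by
    rintro c ⟨u, v⟩ ⟨ψ₁, ψ₂, h1, h2, h3, a, b, d, ha, hb, hd, he, hf⟩
    have key : ∀ (l : Filter ℝ), l ≤ ae volume → ∀ (f : L2) (p : ℂ),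
        Tendsto (fun x => f x) l (𝓝 p) → Tendsto (fun x => (c • f : L2) x) l (𝓝 (c * p)) := by
      intro l hl f p hp
      refine (hp.const_mul c).congr' ?_
      exact hl ((Lp.coeFn_smul c f).mono fun x hx => hx.symm)
    have hr : rightZero ≤ ae volume := inf_le_right
    have hl : leftZero ≤ ae volume := inf_le_right
    refine ⟨c • ψ₁, c • ψ₂, h1.smul c, h2.smul c, ?_, c * a, c * b, c * d,
      key _ hr _ _ ha, key _ hl _ _ hb, key _ hr _ _ hd, key _ hl _ _ he, ?_⟩
    · simp only at h3 ⊢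
      rw [Prod.smul_snd, h3]; simp only; rw [smul_neg]
    · linear_combination c * hf

/-- The Hamiltonian `H_γ` of the `δ'` interaction, as an unbounded operator in `L²(ℝ)`. -/
def hamiltonian (γ : ℝ) : L2 →ₗ.[ℂ] L2 := (hamiltonianGraph γ).toLinearPMap

/-- The graph of `H_γ` is the set of pairs it was built from: `ψ''` is determined by `ψ`. -/
theorem hamiltonian_graph (γ : ℝ) : (hamiltonian γ).graph = hamiltonianGraph γ := by
  refine Submodule.toLinearPMap_graph_eq _ ?_
  rintro ⟨u, v⟩ ⟨ψ₁, ψ₂, h1, h2, h3, -⟩ hu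
  simp only at h1 h3 hu ⊢
  subst hu
  have e1 := h1.eq_zero
  subst e1
  rw [h3, h2.eq_zero, neg_zero]

/-- `U` is the unitary group `t ↦ e^{-itA}`: a strongly continuous one-parameter group of unitary
operators whose infinitesimal generator is exactly `-iA` (same domain, same values). By Stone's
theorem such a `U` exists if and only if `A` is self-adjoint, and it is then unique. -/
structure IsUnitaryGroup {E : Type*} [NormedAddCommGroup E] [InnerProductSpace ℂ E]
    [CompleteSpace E] (A : E →ₗ.[ℂ] E) (U : ℝ → E →L[ℂ] E) : Prop where
  unitary : ∀ t, U t ∈ unitary (E →L[ℂ] E)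
  zero : U 0 = 1
  add : ∀ s t, U (s + t) = U s * U t
  continuous : ∀ x, Continuous fun t => U t x
  generator : ∀ x y : E,
    (x, y) ∈ A.graph ↔ HasDerivAt (fun t => U t x) (-(Complex.I • y)) 0

open scoped Classical in
/-- The unitary group `t ↦ e^{-itA}` generated by a self-adjoint operator `A` (and `0` by
convention if `A` does not generate a unitary group). -/
def unitaryGroup {E : Type*} [NormedAddCommGroup E] [InnerProductSpace ℂ E]
    [CompleteSpace E] (A : E →ₗ.[ℂ] E) : ℝ → E →L[ℂ] E :=
  if h : ∃ U, IsUnitaryGroup A U then h.choose else 0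

open scoped Classical in
/-- The nonlinearity `|f|^{2μ} f` as an element of `L²(ℝ)`. It is square integrable for every
`f ∈ Q`, since such `f` are bounded; the value `0` is used for those `f ∈ L²(ℝ)` for which it
is not. -/
def nonlinearity (μ : ℝ) (f : L2) : L2 :=
  if h : MemLp (fun x => ‖f x‖ ^ (2 * μ) • f x) 2 (volume : Measure ℝ) then h.toLp else 0

/-- The energy
`E(ψ) = ½ ‖ψ'‖² - (1/(2γ)) |ψ(0+) - ψ(0-)|² - (l/(2μ+2)) ∫ |ψ|^{2μ+2}`, with coupling `l`. -/
def energy (γ l μ : ℝ) (ψ : Q) : ℝ :=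
  1 / 2 * ‖ψ.der‖ ^ 2 - 1 / (2 * γ) * ‖rightTrace ψ.fn - leftTrace ψ.fn‖ ^ 2
    - l / (2 * μ + 2) * ∫ x, ‖ψ.fn x‖ ^ (2 * μ + 2)

/-- The time interval `[0, T)`, where `T` may be `+∞`. -/
def timeInterval (T : EReal) : Set ℝ := {t | 0 ≤ t ∧ (t : EReal) < T}

/-- `ψ ∈ C⁰([0,T), Q)` is a solution, with initial datum `ψ₀ ∈ Q`, of
`ψ(t) = e^{-iH_γ t} ψ₀ + i l ∫₀ᵗ e^{-iH_γ (t-s)} |ψ(s)|^{2μ} ψ(s) ds`;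
the integral is a Bochner integral of a continuous `L²(ℝ)`-valued function. -/
structure IsSolution (γ l μ : ℝ) (T : EReal) (ψ₀ : Q) (ψ : ℝ → Q) : Prop where
  continuousOn : ContinuousOn ψ (timeInterval T)
  initial : 0 ∈ timeInterval T → ψ 0 = ψ₀
  duhamel : ∀ t ∈ timeInterval T,
    (ψ t).fn = unitaryGroup (hamiltonian γ) t ψ₀.fn
      + (Complex.I * l) • ∫ s in (0 : ℝ)..t,
          unitaryGroup (hamiltonian γ) (t - s) (nonlinearity μ (ψ s).fn)

end DeltaPrime

end

/-! For the mass, remove the free evolution: `φ(t) = U(-t) ψ(t)` is continuously differentiable in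
`L²` with no domain condition, and half the derivative of `‖φ‖²` is `Re ⟨ψ, iλ|ψ|^{2μ}ψ⟩ = 0`
(`IsUnitaryGroup.norm_mild`). For the energy, the formal computation pairs `∂ₜψ` with `H_γ ψ`, which
is meaningless when `ψ` is only continuous in `Q`. Time integrals of a mild solution, however, lie
in `D(H_γ)` and satisfy the integrated equation strongly (`integral_mild_mem_graph`). Integration by
parts turns this into an identity for the quadratic form, tested against any `v ∈ Q`
(`form_integral_eq`). So the Steklov average `h⁻¹ ∫_t^{t+h} ψ` replaces `ψ` in the quadratic part of
`E`, and the potential is averaged separately. The derivative in `t` of this averaged energy is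
computed by testing with `v = ψ(t+h) - ψ(t)`: the term `i‖v‖²` has zero real part, and the two main
terms `± λ h⁻¹ Re ⟨|ψ(t)|^{2μ}ψ(t), v⟩` cancel. The remainder is of order `h⁻¹ σ²`, where `σ` bounds
`‖ψ(s) - ψ(t)‖` in `L²` for `s ∈ [t, t+h]`. The same identity gives `‖v‖² ≤ C h ‖v‖_Q`
(`norm_fn_sub_sq_le`), and `‖v‖_Q ≤ ε` for small `h` by uniform continuity in `Q`. Hence `σ² ≤ C h
ε`, the derivative is `O(ε)`, and letting `h → 0` gives conservation. Self-adjointness of `H_γ` is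
not used: if no unitary group exists, the propagator is `0` by convention and the solution is
constant. -/

noncomputable section

namespace DeltaPrime

/-! ### Weak derivatives on an interval and the product rule for primitives -/

section

open Set

/-- A smooth function with compact support in an interval `U` and vanishing integral has a primitive
of the same kind. -/
theorem exists_test_primitive {U : Set ℝ} (hU : U.OrdConnected) {η : ℝ → ℝ} (hη : ContDiff ℝ ∞ η)
    (hc : HasCompactSupport η) (hs : tsupport η ⊆ U) (h0 : ∫ x, η x = 0) :
    ∃ φ : ℝ → ℝ, ContDiff ℝ ∞ φ ∧ HasCompactSupport φ ∧ tsupport φ ⊆ U ∧ deriv φ = η := by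
  rcases (tsupport η).eq_empty_or_nonempty with he | hne
  · have : η = 0 := tsupport_eq_empty_iff.mp he
    subst this
    exact ⟨0, contDiff_const, HasCompactSupport.zero, by simp, by ext; simp⟩
  have hK : IsCompact (tsupport η) := hc
  have ha := hK.sInf_mem hne
  have hb := hK.sSup_mem hne
  set a := sInf (tsupport η)
  set b := sSup (tsupport η)
  have hab : tsupport η ⊆ Icc a b := fun x hx =>
    ⟨csInf_le hK.bddBelow hx, le_csSup hK.bddAbove hx⟩
  have hsub : Icc a b ⊆ U := hU.out (hs ha) (hs hb)
  have hz : ∀ y, y ∉ Icc a b → η y = 0 := fun y hy =>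
    image_eq_zero_of_notMem_tsupport fun h => hy (hab h)
  -- The primitive starts strictly to the left of the support. It vanishes left of `a` trivially and
  -- right of `b` because the total integral is zero.
  have hd : deriv (fun x => ∫ y in (a - 1)..x, η y) = η := by
    ext x
    exact hη.continuous.deriv_integral _ _ _
  have hsupp : Function.support (fun x => ∫ y in (a - 1)..x, η y) ⊆ Icc a b := by
    intro x hx
    by_contra hxab
    apply hx
    rcases lt_or_ge x a with hxa | hxa
    · refine intervalIntegral.integral_zero_ae (Eventually.of_forall fun y hy => hz y fun h => ?_)
      have := hy.2
      have h1 := h.1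
      simp only [le_sup_iff] at this
      rcases this with h | h <;> linarith
    · have hxb : b < x := by
        by_contra h
        exact hxab ⟨hxa, not_lt.mp h⟩
      simp only
      rw [intervalIntegral.integral_eq_integral_of_support_subset, h0]
      intro y hy
      have := hab (subset_tsupport _ hy)
      exact ⟨by linarith [this.1], by linarith [this.2]⟩
  have htsupp := closure_minimal hsupp isClosed_Icc
  refine ⟨fun x => ∫ y in (a - 1)..x, η y, ?_, ?_, htsupp.trans hsub, hd⟩
  · rw [contDiff_infty_iff_deriv, hd]
    refine ⟨fun x => ?_, hη⟩
    exact (intervalIntegral.integral_hasDerivAt_right (hη.continuous.intervalIntegrable _ _)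
      (hη.continuous.stronglyMeasurableAtFilter _ _) hη.continuous.continuousAt).differentiableAt
  · exact isCompact_Icc.of_isClosed_subset (isClosed_tsupport _) htsupp

/-- The du Bois-Reymond lemma: a locally integrable function with vanishing weak derivative on an
open interval is almost everywhere constant there. -/
theorem ae_eq_const_of_integral_deriv_smul_eq_zero {U : Set ℝ} (hU : IsOpen U)
    (hU' : U.OrdConnected) (hne : U.Nonempty) {h : ℝ → ℂ} (hh : LocallyIntegrable h)
    (H : ∀ φ : ℝ → ℝ, ContDiff ℝ ∞ φ → HasCompactSupport φ → tsupport φ ⊆ U →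
      ∫ x, deriv φ x • h x = 0) :
    ∃ c, ∀ᵐ x, x ∈ U → h x = c := by
  obtain ⟨x₀, hx₀⟩ := hne
  obtain ⟨ρ, hρs, hρc, hρ, hρr, hρ1⟩ :=
    exists_contDiff_tsupport_subset (n := ⊤) (hU.mem_nhds hx₀)
  have hpos : 0 < ∫ x, ρ x :=
    hρ.continuous.integral_pos_of_hasCompactSupport_nonneg_nonzero hρc
      (fun x => (hρr ⟨x, rfl⟩).1) (x := x₀) (by simp [hρ1])
  set r := ∫ x, ρ x
  -- The constant is forced: it is the mean of `h` with weight `ρ / r`.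
  set c : ℂ := r⁻¹ • ∫ x, ρ x • h x with hcdef
  refine ⟨c, ?_⟩
  have hint : ∀ θ : ℝ → ℝ, ContDiff ℝ ∞ θ → HasCompactSupport θ → Integrable (fun x => θ x • h x) :=
    fun θ h1 h2 => hh.integrable_smul_left_of_hasCompactSupport h1.continuous h2
  have h0 : ∀ᵐ x, x ∈ U → h x - c = 0 := by
    refine hU.ae_eq_zero_of_integral_contDiff_smul_eq_zero
      ((hh.sub (locallyIntegrable_const c)).locallyIntegrableOn _) ?_
    intro θ hθ hθc hθs
    set I := ∫ x, θ x with hI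
    have hθi : Integrable θ := hθ.continuous.integrable_of_hasCompactSupport hθc
    have hρi : Integrable ρ := hρ.continuous.integrable_of_hasCompactSupport hρc
    -- Subtracting the right multiple of `ρ` makes the integral vanish, so the difference is the
    -- derivative of a test function.
    have hηsm : ContDiff ℝ ∞ (fun x => θ x - (I * r⁻¹) * ρ x) := hθ.sub (contDiff_const.mul hρ)
    have hηc : HasCompactSupport (fun x => θ x - (I * r⁻¹) * ρ x) :=
      hθc.sub (hρc.mul_left (f := fun _ => I * r⁻¹))
    have hηs : tsupport (fun x => θ x - (I * r⁻¹) * ρ x) ⊆ U := by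
      refine (tsupport_sub θ (fun x => (I * r⁻¹) * ρ x)).trans (union_subset hθs ?_)
      exact (tsupport_mul_subset_right (f := fun _ => I * r⁻¹)).trans hρs
    have hη0 : ∫ x, (θ x - (I * r⁻¹) * ρ x) = 0 := by
      rw [integral_sub hθi (hρi.const_mul _), integral_const_mul, mul_assoc,
        inv_mul_cancel₀ hpos.ne', mul_one, sub_self]
    obtain ⟨φ, hφ, hφc, hφs, hφd⟩ := exists_test_primitive hU' hηsm hηc hηs hη0
    have h1 := H φ hφ hφc hφs
    rw [hφd] at h1
    have h2 : ∫ x, (θ x - (I * r⁻¹) * ρ x) • h x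
        = (∫ x, θ x • h x) - (I * r⁻¹) • ∫ x, ρ x • h x := by
      have hi : Integrable (fun x => (I * r⁻¹) • ρ x • h x) := (hint ρ hρ hρc).smul (I * r⁻¹)
      rw [← integral_smul, ← integral_sub (hint θ hθ hθc) hi]
      refine integral_congr_ae (Eventually.of_forall fun x => ?_)
      simp only [sub_smul, mul_smul]
    have h3 : ∫ x, θ x • (h x - c) = (∫ x, θ x • h x) - I • c := by
      simp only [smul_sub]
      rw [integral_sub (hint θ hθ hθc) (hθi.smul_const c), integral_smul_const]
    rw [h3, hcdef, smul_smul, ← h2, h1]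
  filter_upwards [h0] with x hx hxU
  exact sub_eq_zero.mp (hx hxU)

theorem absolutelyContinuousOnInterval_primitive {g : ℝ → ℂ} (hg : LocallyIntegrable g) (c : ℂ)
    (a b : ℝ) : AbsolutelyContinuousOnInterval (fun x => c + ∫ y in (0 : ℝ)..x, g y) a b := by
  -- A symmetric interval contains both `[a, b]` and the base point `0` of the primitive.
  set R := |a| + |b|
  have hR : uIcc a b ⊆ uIcc (-R) R := by
    have h0 : -R ≤ R := by have := abs_nonneg a; have := abs_nonneg b; simp only [R]; linarith
    rw [uIcc_of_le h0]
    refine uIcc_subset_Icc ?_ ?_ <;> constructor <;> simp only [R] <;>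
      linarith [neg_abs_le a, le_abs_self a, neg_abs_le b, le_abs_self b, abs_nonneg a, abs_nonneg b]
  have h0 : (0 : ℝ) ∈ uIcc (-R) R := by
    have : 0 ≤ R := by positivity
    rw [uIcc_of_le (by linarith)]; exact ⟨by linarith, this⟩
  have hgi : ∀ u v : ℝ, IntervalIntegrable g volume u v := fun u v => (hg.integrableOn_isCompact isCompact_uIcc).intervalIntegrable
  have hcst : ∀ z : ℂ, AbsolutelyContinuousOnInterval (fun _ : ℝ => z) (-R) R := fun z =>
    (LipschitzWith.const (α := ℝ) z).lipschitzOnWith.absolutelyContinuousOnInterval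
  have hre : IntervalIntegrable (fun x => (g x).re) volume (-R) R :=
    ⟨(hgi _ _).1.re, (hgi _ _).2.re⟩
  have him : IntervalIntegrable (fun x => (g x).im) volume (-R) R :=
    ⟨(hgi _ _).1.im, (hgi _ _).2.im⟩
  have h1 := (hre.absolutelyContinuousOnInterval_intervalIntegral h0).smul (hcst 1)
  have h2 := (him.absolutelyContinuousOnInterval_intervalIntegral h0).smul (hcst Complex.I)
  have h3 := (hcst c).add (h1.add h2)
  refine AbsolutelyContinuousOnInterval.mono ?_ hR
  refine (congrArg (AbsolutelyContinuousOnInterval · (-R) R) (funext fun x => ?_)).mp h3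
  have e1 := Complex.reCLM.intervalIntegral_comp_comm (hgi 0 x)
  have e2 := Complex.imCLM.intervalIntegral_comp_comm (hgi 0 x)
  simp only [Complex.reCLM_apply, Complex.imCLM_apply] at e1 e2
  simp only [Pi.add_apply, Pi.smul_apply', e1, e2, Complex.real_smul, mul_one]
  rw [Complex.re_add_im]

/-- The product rule for primitives of locally integrable functions. -/
theorem integral_primitive_mul_primitive {g m : ℝ → ℂ} (hg : LocallyIntegrable g)
    (hm : LocallyIntegrable m) (c d : ℂ) (a b : ℝ) :
    ∫ x in a..b, (g x * (d + ∫ y in (0 : ℝ)..x, m y) + (c + ∫ y in (0 : ℝ)..x, g y) * m x)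
      = (c + ∫ y in (0 : ℝ)..b, g y) * (d + ∫ y in (0 : ℝ)..b, m y)
        - (c + ∫ y in (0 : ℝ)..a, g y) * (d + ∫ y in (0 : ℝ)..a, m y) := by
  set F : ℝ → ℂ := fun x => c + ∫ y in (0 : ℝ)..x, g y with hF
  set K : ℝ → ℂ := fun x => d + ∫ y in (0 : ℝ)..x, m y with hK
  have hcont : ∀ (e : ℂ) (k : ℝ → ℂ), LocallyIntegrable k →
      Continuous fun x => e + ∫ y in (0 : ℝ)..x, k y := fun e k hk =>
    continuous_const.add (intervalIntegral.continuous_primitive (fun u v =>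
      (hk.integrableOn_isCompact isCompact_uIcc).intervalIntegrable) 0)
  have hFc : Continuous F := hcont c g hg
  have hKc : Continuous K := hcont d m hm
  have hq : LocallyIntegrable (fun x => g x * K x + F x * m x) := by
    refine LocallyIntegrable.add ?_ ?_
    · simpa [mul_comm] using hg.continuous_mul hKc
    · exact hm.continuous_mul hFc
  have h1 := (absolutelyContinuousOnInterval_primitive hg c a b).fun_smul
    (absolutelyContinuousOnInterval_primitive hm d a b)
  -- The product minus the primitive of its almost everywhere derivative is absolutely continuous
  -- with zero derivative, hence constant.
  have h2 := h1.sub (absolutelyContinuousOnInterval_primitive hq 0 a b)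
  obtain ⟨C, hC⟩ := h2.const_of_ae_hasDerivAt_zero (by
    filter_upwards [LocallyIntegrable.ae_hasDerivAt_integral hg, LocallyIntegrable.ae_hasDerivAt_integral hm,
      LocallyIntegrable.ae_hasDerivAt_integral hq] with x e1 e2 e3 _
    have := (((e1 0).const_add c).mul ((e2 0).const_add d)).sub ((e3 0).const_add 0)
    exact this.congr_deriv (sub_self _))
  have ea := hC a left_mem_uIcc
  have eb := hC b right_mem_uIcc
  simp only [Pi.sub_apply, smul_eq_mul, zero_add] at ea eb
  have hi : ∀ u v : ℝ, IntervalIntegrable (fun x => g x * K x + F x * m x) volume u v :=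
    fun u v => (hq.integrableOn_isCompact isCompact_uIcc).intervalIntegrable
  have := intervalIntegral.integral_interval_sub_left (hi 0 b) (hi 0 a)
  rw [← this]
  linear_combination ea - eb

end

/-! ### Integration by parts on the half-lines -/

section

open Set

theorem continuous_add_primitive {g : ℝ → ℂ} (hg : LocallyIntegrable g) (c : ℂ) :
    Continuous fun x => c + ∫ y in (0 : ℝ)..x, g y :=
  continuous_const.add (intervalIntegral.continuous_primitive
    (fun _ _ => (hg.integrableOn_isCompact isCompact_uIcc).intervalIntegrable) 0)

/-- Integration by parts of a primitive against a test function. -/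
theorem integral_deriv_smul_primitive {g : ℝ → ℂ} (hg : LocallyIntegrable g) {φ : ℝ → ℝ}
    (hφ : ContDiff ℝ ∞ φ) (hc : HasCompactSupport φ) :
    ∫ x, deriv φ x • ∫ y in (0 : ℝ)..x, g y = -∫ x, φ x • g x := by
  obtain ⟨R₀, hR₀⟩ := hc.isCompact.isBounded.subset_closedBall 0
  have hz : ∀ x, R₀ < |x| → φ x = 0 := fun x hx =>
    image_eq_zero_of_notMem_tsupport fun h => by
      have := hR₀ h
      rw [mem_closedBall_zero_iff, Real.norm_eq_abs] at this
      linarith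
  -- The absolute value is needed because `R₀` may be negative when the support is empty.
  set R := |R₀| + 1
  have hRpos : 0 < R := by positivity
  have hR : R₀ < R := (le_abs_self _).trans_lt (lt_add_one _)
  have hdc : Continuous (deriv φ) := hφ.continuous_deriv (by simp)
  have hd : LocallyIntegrable (fun x => Complex.ofReal (deriv φ x)) volume :=
    (Complex.continuous_ofReal.comp hdc).locallyIntegrable (μ := volume)
  have hG : Continuous fun x => ∫ y in (0 : ℝ)..x, g y := by
    simpa using continuous_add_primitive hg 0
  -- Writing `φ` as a primitive of `deriv φ` puts it in the form required by the product rule.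
  have hprim : ∀ x, (φ 0 : ℂ) + ∫ y in (0 : ℝ)..x, Complex.ofReal (deriv φ y) = φ x := by
    intro x
    rw [intervalIntegral.integral_ofReal, intervalIntegral.integral_deriv_eq_sub
      (fun y _ => (hφ.differentiable (by simp)).differentiableAt) (hdc.intervalIntegrable _ _)]
    push_cast; ring
  have key := integral_primitive_mul_primitive hd hg (φ 0 : ℂ) 0 (-R) R
  simp only [hprim, zero_add] at key
  rw [hz R (by rwa [abs_of_pos hRpos]), hz (-R) (by rwa [abs_neg, abs_of_pos hRpos])] at key
  have hi1 : Integrable fun x => deriv φ x • ∫ y in (0 : ℝ)..x, g y :=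
    (hdc.smul hG).integrable_of_hasCompactSupport (hc.deriv.smul_right)
  have hi2 : Integrable fun x => φ x • g x :=
    hg.integrable_smul_left_of_hasCompactSupport hφ.continuous hc
  have hsupp : Function.support
      (fun x => (deriv φ x • ∫ y in (0 : ℝ)..x, g y) + φ x • g x) ⊆ Ioc (-R) R := by
    intro x hx
    have hx' : x ∈ tsupport φ := by
      by_contra h
      apply hx
      have h1 : deriv φ x = 0 := image_eq_zero_of_notMem_tsupport fun h' =>
        h (tsupport_deriv_subset h')
      simp [h1, image_eq_zero_of_notMem_tsupport h]
    have := hR₀ hx'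
    rw [mem_closedBall_zero_iff, Real.norm_eq_abs] at this
    have := abs_lt.mp (this.trans_lt hR)
    exact ⟨this.1, this.2.le⟩
  have h2 := intervalIntegral.integral_eq_integral_of_support_subset (μ := volume) hsupp
  rw [integral_add hi1 hi2] at h2
  simp only [Complex.real_smul] at h2 ⊢
  rw [key] at h2
  simp only [Complex.ofReal_zero, zero_mul, sub_zero] at h2
  linear_combination -h2

/-- An `L²` function with an `L²` weak derivative off the origin is, on each half-line, a primitive
of that derivative. -/
theorem HasWeakDeriv.exists_primitive {f g : L2} (h : HasWeakDeriv f g) :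
    ∃ c d : ℂ, (∀ᵐ x : ℝ, 0 < x → f x = c + ∫ y in (0 : ℝ)..x, g y) ∧
      ∀ᵐ x : ℝ, x < 0 → f x = d + ∫ y in (0 : ℝ)..x, g y := by
  have hf : LocallyIntegrable f := (Lp.memLp f).locallyIntegrable one_le_two
  have hg : LocallyIntegrable g := (Lp.memLp g).locallyIntegrable one_le_two
  have hG : Continuous fun x => ∫ y in (0 : ℝ)..x, g y := by
    simpa using continuous_add_primitive hg 0
  -- On an interval avoiding `0`, `f` minus the primitive of `g` has zero weak derivative. The two
  -- half-lines yield unrelated constants.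
  have key : ∀ U : Set ℝ, IsOpen U → U.OrdConnected → U.Nonempty → U ⊆ {0}ᶜ →
      ∃ c, ∀ᵐ x, x ∈ U → f x - (∫ y in (0 : ℝ)..x, g y) = c := by
    intro U hU hU' hne hU0
    refine ae_eq_const_of_integral_deriv_smul_eq_zero hU hU' hne
      (hf.sub hG.locallyIntegrable) fun φ hφ hc hs => ?_
    have hdc : Continuous (deriv φ) := hφ.continuous_deriv (by simp)
    have hi : Integrable fun x => deriv φ x • ∫ y in (0 : ℝ)..x, g y :=
      (hdc.smul hG).integrable_of_hasCompactSupport (hc.deriv.smul_right)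
    simp only [smul_sub]
    rw [integral_sub (integrable_test_smul f hdc hc.deriv) hi, h φ hφ hc (hs.trans hU0),
      integral_deriv_smul_primitive hg hφ hc, sub_self]
  obtain ⟨c, hc⟩ := key (Ioi 0) isOpen_Ioi ordConnected_Ioi nonempty_Ioi (by
    intro x hx h; exact (ne_of_gt hx) h)
  obtain ⟨d, hd⟩ := key (Iio 0) isOpen_Iio ordConnected_Iio nonempty_Iio (by
    intro x hx h; exact (ne_of_lt hx) h)
  refine ⟨c, d, hc.mono fun x hx h0 => ?_, hd.mono fun x hx h0 => ?_⟩
  · rw [← hx h0]; ring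
  · rw [← hx h0]; ring

theorem integrable_mul_of_memLp_two {f g : ℝ → ℂ} (hf : MemLp f 2 volume) (hg : MemLp g 2 volume) :
    Integrable fun x => f x * g x :=
  hf.integrable_mul hg

/-- Integration by parts on a right half-line. -/
theorem setIntegral_Ioi_mul_add_mul {f g k m : ℝ → ℂ} (hf : MemLp f 2 volume)
    (hg : MemLp g 2 volume) (hk : MemLp k 2 volume) (hm : MemLp m 2 volume) {c d : ℂ}
    (hfg : ∀ᵐ x : ℝ, 0 < x → f x = c + ∫ y in (0 : ℝ)..x, g y)
    (hkm : ∀ᵐ x : ℝ, 0 < x → k x = d + ∫ y in (0 : ℝ)..x, m y) {a : ℝ} (ha : 0 ≤ a) :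
    ∫ x in Ioi a, (g x * k x + f x * m x)
      = -((c + ∫ y in (0 : ℝ)..a, g y) * (d + ∫ y in (0 : ℝ)..a, m y)) := by
  have hgl := hg.locallyIntegrable one_le_two
  have hml := hm.locallyIntegrable one_le_two
  set F : ℝ → ℂ := fun x => c + ∫ y in (0 : ℝ)..x, g y with hF
  set K : ℝ → ℂ := fun x => d + ∫ y in (0 : ℝ)..x, m y with hK
  have hi : IntegrableOn (fun x => g x * k x + f x * m x) (Ioi a) :=
    ((integrable_mul_of_memLp_two hg hk).add (integrable_mul_of_memLp_two hf hm)).integrableOn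
  have hae : ∀ᵐ x ∂(volume.restrict (Ioi a)), f x = F x ∧ k x = K x := by
    rw [ae_restrict_iff' measurableSet_Ioi]
    filter_upwards [hfg, hkm] with x h1 h2 hx
    exact ⟨h1 (ha.trans_lt hx), h2 (ha.trans_lt hx)⟩
  have hi' : IntegrableOn (fun x => F x * K x) (Ioi a) := by
    refine Integrable.congr (integrable_mul_of_memLp_two hf hk).integrableOn (hae.mono fun x hx => ?_)
    simp only [hx.1, hx.2]
  have ht := intervalIntegral_tendsto_integral_Ioi a hi tendsto_id
  have heq : ∀ᶠ R in atTop, ∫ x in a..id R, (g x * k x + f x * m x) = F R * K R - F a * K a := by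
    filter_upwards [eventually_ge_atTop a] with R hR
    rw [← integral_primitive_mul_primitive hgl hml c d a R]
    refine intervalIntegral.integral_congr_ae ?_
    rw [ae_restrict_iff' measurableSet_Ioi] at hae
    filter_upwards [hae] with x hx hxR
    rw [id, uIoc_of_le hR] at hxR
    obtain ⟨h1, h2⟩ := hx hxR.1
    rw [h1, h2]
  have ht2 : Tendsto (fun R => F R * K R) atTop
      (𝓝 ((∫ x in Ioi a, (g x * k x + f x * m x)) + F a * K a)) := by
    have := (ht.congr' heq).add_const (F a * K a)
    simpa using this
  -- There is no boundary term at infinity: `F * K` is integrable and has a limit, which must then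
  -- be zero.
  have h0 := IntegrableAtFilter.eq_zero_of_tendsto (μ := volume)
    ⟨Ioi a, Ioi_mem_atTop _, hi'⟩ (fun s hs => by
      rcases mem_atTop_sets.1 hs with ⟨b, hb⟩
      rw [← top_le_iff, ← Real.volume_Ici (a := b)]
      exact measure_mono hb) ht2
  linear_combination h0

/-- Integration by parts on a left half-line. -/
theorem setIntegral_Iic_mul_add_mul {f g k m : ℝ → ℂ} (hf : MemLp f 2 volume)
    (hg : MemLp g 2 volume) (hk : MemLp k 2 volume) (hm : MemLp m 2 volume) {c d : ℂ}
    (hfg : ∀ᵐ x : ℝ, x < 0 → f x = c + ∫ y in (0 : ℝ)..x, g y)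
    (hkm : ∀ᵐ x : ℝ, x < 0 → k x = d + ∫ y in (0 : ℝ)..x, m y) {a : ℝ} (ha : a ≤ 0) :
    ∫ x in Iic a, (g x * k x + f x * m x)
      = (c + ∫ y in (0 : ℝ)..a, g y) * (d + ∫ y in (0 : ℝ)..a, m y) := by
  -- The reflection `x ↦ -x` reduces the claim to the right half-line.
  have hneg := Measure.measurePreserving_neg (volume : Measure ℝ)
  have hp : ∀ (e : ℂ) (u v : ℝ → ℂ), (∀ᵐ x : ℝ, x < 0 → u x = e + ∫ y in (0 : ℝ)..x, v y) →
      ∀ᵐ x : ℝ, 0 < x → u (-x) = e + ∫ y in (0 : ℝ)..x, -v (-y) := by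
    intro e u v h
    filter_upwards [hneg.quasiMeasurePreserving.ae h] with x hx h0
    rw [hx (by linarith), intervalIntegral.integral_neg, intervalIntegral.integral_comp_neg,
      intervalIntegral.integral_symm, neg_zero]
  have := setIntegral_Ioi_mul_add_mul (hf.comp_measurePreserving hneg)
    (hg.comp_measurePreserving hneg).neg (hk.comp_measurePreserving hneg)
    (hm.comp_measurePreserving hneg).neg (hp c f g hfg) (hp d k m hkm) (a := -a) (by linarith)
  have h2 := integral_comp_neg_Ioi (-a) (fun x => -(g x * k x + f x * m x))
  rw [neg_neg] at h2
  have hprim : ∀ v : ℝ → ℂ, ∫ y in (0 : ℝ)..-a, -v (-y) = ∫ y in (0 : ℝ)..a, v y := by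
    intro v
    rw [intervalIntegral.integral_neg, intervalIntegral.integral_comp_neg,
      intervalIntegral.integral_symm]
    simp
  simp only [Pi.neg_apply, Function.comp_apply, hprim] at this
  rw [integral_neg (μ := volume.restrict (Iic a))] at h2
  rw [← neg_inj, ← h2, ← this]
  refine integral_congr_ae (Eventually.of_forall fun x => ?_)
  simp only
  ring

end

/-! ### Boundary values, the Sobolev bound and the quadratic form of `H_γ` -/

section

open Set ComplexConjugate

/-- A null set contains no interval. This makes limits along the filter unique, so that `limUnder`
returns the boundary value. -/
instance rightZero_neBot : rightZero.NeBot := by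
  refine Filter.inf_neBot_iff.mpr fun s hs t ht => ?_
  obtain ⟨u, hu, hus⟩ := mem_nhdsGT_iff_exists_Ioo_subset.mp hs
  by_contra h
  have h1 : Ioo 0 u ⊆ tᶜ := fun x hx hxt => h ⟨x, hus hx, hxt⟩
  have h2 := measure_mono_null h1 (mem_ae_iff.mp ht)
  rw [Real.volume_Ioo, ENNReal.ofReal_eq_zero] at h2
  linarith [mem_Ioi.mp hu]

instance leftZero_neBot : leftZero.NeBot := by
  refine Filter.inf_neBot_iff.mpr fun s hs t ht => ?_
  obtain ⟨u, hu, hus⟩ := mem_nhdsLT_iff_exists_Ioo_subset.mp hs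
  by_contra h
  have h1 : Ioo u 0 ⊆ tᶜ := fun x hx hxt => h ⟨x, hus hx, hxt⟩
  have h2 := measure_mono_null h1 (mem_ae_iff.mp ht)
  rw [Real.volume_Ioo, ENNReal.ofReal_eq_zero] at h2
  linarith [mem_Iio.mp hu]

theorem rightZero_le_ae : rightZero ≤ ae volume := inf_le_right

theorem leftZero_le_ae : leftZero ≤ ae volume := inf_le_right

theorem norm_sq_eq_integral (f : L2) : ‖f‖ ^ 2 = ∫ x, ‖f x‖ ^ 2 := by
  have h := L2.inner_def (𝕜 := ℂ) f f
  have h1 : inner ℂ f f = ((‖f‖ ^ 2 : ℝ) : ℂ) := by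
    rw [inner_self_eq_norm_sq_to_K]; push_cast; rfl
  have h2 : ∫ x, inner ℂ (f x) (f x) = ((∫ x, ‖f x‖ ^ 2 : ℝ) : ℂ) := by
    rw [← integral_complex_ofReal]
    refine integral_congr_ae (Eventually.of_forall fun x => ?_)
    simp only
    rw [inner_self_eq_norm_sq_to_K]; push_cast; rfl
  rw [h1, h2] at h
  exact_mod_cast h

theorem integrable_norm_sq (f : L2) : Integrable fun x => ‖f x‖ ^ 2 :=
  (memLp_two_iff_integrable_sq_norm (Lp.aestronglyMeasurable f)).mp (Lp.memLp f)

theorem memLp_conj (f : L2) : MemLp (fun x => conj (f x)) 2 (volume : Measure ℝ) :=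
  (Lp.memLp f).of_le (Complex.continuous_conj.comp_aestronglyMeasurable
    (Lp.aestronglyMeasurable f)) (Eventually.of_forall fun x => by simp)

theorem conj_add_primitive {f g : ℝ → ℂ} {c : ℂ} {p : ℝ → Prop}
    (h : ∀ᵐ x : ℝ, p x → f x = c + ∫ y in (0 : ℝ)..x, g y) :
    ∀ᵐ x : ℝ, p x → conj (f x) = conj c + ∫ y in (0 : ℝ)..x, conj (g y) :=
  h.mono fun x hx hp => by rw [hx hp, map_add, intervalIntegral.intervalIntegral_conj]

theorem norm_setIntegral_le (f g : L2) (s : Set ℝ) :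
    ‖∫ x in s, (g x * conj (f x) + f x * conj (g x))‖ ≤ ‖f‖ ^ 2 + ‖g‖ ^ 2 := by
  have hi : Integrable fun x => ‖f x‖ ^ 2 + ‖g x‖ ^ 2 :=
    (integrable_norm_sq f).add (integrable_norm_sq g)
  rw [norm_sq_eq_integral f, norm_sq_eq_integral g,
    ← integral_add (integrable_norm_sq f) (integrable_norm_sq g)]
  refine (norm_integral_le_of_norm_le hi.integrableOn (Eventually.of_forall fun x => ?_)).trans
    (setIntegral_le_integral hi (Eventually.of_forall fun x => by positivity))
  refine (norm_add_le _ _).trans ?_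
  simp only [norm_mul, RCLike.norm_conj]
  nlinarith [sq_nonneg (‖f x‖ - ‖g x‖)]

/-- `|f(a)|²` is minus the integral of `(|f|²)'` over `(a, ∞)`, and `|(|f|²)'| ≤ 2|f||f'| ≤ |f|² +
|f'|²`. The point `a = 0` is included, which also bounds the trace. -/
theorem norm_sq_add_primitive_le_of_nonneg {f g : L2} {c : ℂ}
    (h : ∀ᵐ x : ℝ, 0 < x → f x = c + ∫ y in (0 : ℝ)..x, g y) {a : ℝ} (ha : 0 ≤ a) :
    ‖c + ∫ y in (0 : ℝ)..a, g y‖ ^ 2 ≤ ‖f‖ ^ 2 + ‖g‖ ^ 2 := by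
  have h1 := setIntegral_Ioi_mul_add_mul (Lp.memLp f) (Lp.memLp g) (memLp_conj f) (memLp_conj g)
    h (conj_add_primitive h) ha
  have h2 := norm_setIntegral_le f g (Ioi a)
  rw [h1, intervalIntegral.intervalIntegral_conj, ← map_add, norm_neg, norm_mul, RCLike.norm_conj, ← sq] at h2
  exact h2

theorem norm_sq_add_primitive_le_of_nonpos {f g : L2} {c : ℂ}
    (h : ∀ᵐ x : ℝ, x < 0 → f x = c + ∫ y in (0 : ℝ)..x, g y) {a : ℝ} (ha : a ≤ 0) :
    ‖c + ∫ y in (0 : ℝ)..a, g y‖ ^ 2 ≤ ‖f‖ ^ 2 + ‖g‖ ^ 2 := by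
  have h1 := setIntegral_Iic_mul_add_mul (Lp.memLp f) (Lp.memLp g) (memLp_conj f) (memLp_conj g)
    h (conj_add_primitive h) ha
  have h2 := norm_setIntegral_le f g (Iic a)
  rw [h1, intervalIntegral.intervalIntegral_conj, ← map_add, norm_mul, RCLike.norm_conj, ← sq] at h2
  exact h2

theorem tendsto_of_eq_add_primitive {f : ℝ → ℂ} {g : L2} {c : ℂ} {s : Set ℝ}
    (h : ∀ᵐ x : ℝ, x ∈ s → f x = c + ∫ y in (0 : ℝ)..x, g y) :
    Tendsto f (𝓝[s] 0 ⊓ ae volume) (𝓝 c) := by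
  have hc := (continuous_add_primitive ((Lp.memLp g).locallyIntegrable one_le_two) c).tendsto 0
  simp only [intervalIntegral.integral_same, add_zero] at hc
  refine (hc.mono_left (inf_le_left.trans nhdsWithin_le_nhds)).congr' ?_
  have h1 : ∀ᶠ x in 𝓝[s] 0 ⊓ ae volume, x ∈ s := mem_inf_of_left self_mem_nhdsWithin
  have h2 := (inf_le_right : 𝓝[s] (0 : ℝ) ⊓ ae volume ≤ ae volume) h
  filter_upwards [h1, h2] with x hx hx2
  exact (hx2 hx).symm

/-- The boundary values of a weakly differentiable function are its one-sided limits, and determine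
it on each half-line together with the weak derivative. -/
theorem HasWeakDeriv.traces {f g : L2} (h : HasWeakDeriv f g) :
    (∀ᵐ x : ℝ, 0 < x → f x = rightTrace f + ∫ y in (0 : ℝ)..x, g y) ∧
      (∀ᵐ x : ℝ, x < 0 → f x = leftTrace f + ∫ y in (0 : ℝ)..x, g y) ∧
      Tendsto (fun x => f x) rightZero (𝓝 (rightTrace f)) ∧
      Tendsto (fun x => f x) leftZero (𝓝 (leftTrace f)) := by
  obtain ⟨c, d, hc, hd⟩ := h.exists_primitive
  have h1 : Tendsto (fun x => f x) rightZero (𝓝 c) := tendsto_of_eq_add_primitive hc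
  have h2 : Tendsto (fun x => f x) leftZero (𝓝 d) := tendsto_of_eq_add_primitive hd
  have e1 : rightTrace f = c := h1.limUnder_eq
  have e2 : leftTrace f = d := h2.limUnder_eq
  rw [e1, e2]
  exact ⟨hc, hd, h1, h2⟩

theorem HasWeakDeriv.unique {f g g' : L2} (h : HasWeakDeriv f g) (h' : HasWeakDeriv f g') :
    g = g' := by
  have := h.add (h'.smul (-1))
  simp only [neg_smul, one_smul, add_neg_cancel] at this
  exact sub_eq_zero.mp (by simpa [sub_eq_add_neg] using this.eq_zero)

namespace Q

theorem hasWeakDeriv (ψ : Q) : HasWeakDeriv ψ.fn ψ.der := ψ.2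

/-- The inclusion of the energy space in `L²(ℝ)`. -/
def fnL : Q →L[ℂ] L2 := (WithLp.fstL 2 ℂ L2 L2).comp energySpace.subtypeL

/-- The weak derivative as a bounded operator. -/
def derL : Q →L[ℂ] L2 := (WithLp.sndL 2 ℂ L2 L2).comp energySpace.subtypeL

theorem fnL_apply (ψ : Q) : fnL ψ = ψ.fn := rfl

theorem derL_apply (ψ : Q) : derL ψ = ψ.der := rfl

theorem norm_sq (ψ : Q) : ‖ψ‖ ^ 2 = ‖ψ.fn‖ ^ 2 + ‖ψ.der‖ ^ 2 :=
  WithLp.prod_norm_sq_eq_of_L2 ψ.1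

theorem norm_fn_le (ψ : Q) : ‖ψ.fn‖ ≤ ‖ψ‖ :=
  abs_le_of_sq_le_sq' (by rw [norm_sq]; nlinarith [sq_nonneg ‖ψ.der‖]) (norm_nonneg _) |>.2

theorem norm_der_le (ψ : Q) : ‖ψ.der‖ ≤ ‖ψ‖ :=
  abs_le_of_sq_le_sq' (by rw [norm_sq]; nlinarith [sq_nonneg ‖ψ.fn‖]) (norm_nonneg _) |>.2

theorem norm_rightTrace_le (ψ : Q) : ‖rightTrace ψ.fn‖ ≤ ‖ψ‖ := by
  have := norm_sq_add_primitive_le_of_nonneg ψ.hasWeakDeriv.traces.1 le_rfl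
  rw [← norm_sq, intervalIntegral.integral_same, add_zero] at this
  exact (abs_le_of_sq_le_sq' this (norm_nonneg _)).2

theorem norm_leftTrace_le (ψ : Q) : ‖leftTrace ψ.fn‖ ≤ ‖ψ‖ := by
  have := norm_sq_add_primitive_le_of_nonpos ψ.hasWeakDeriv.traces.2.1 le_rfl
  rw [← norm_sq, intervalIntegral.integral_same, add_zero] at this
  exact (abs_le_of_sq_le_sq' this (norm_nonneg _)).2

/-- The Sobolev inequality: elements of the energy space are bounded by their norm. -/
theorem ae_norm_le (ψ : Q) : ∀ᵐ x : ℝ, ‖ψ.fn x‖ ≤ ‖ψ‖ := by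
  obtain ⟨h1, h2, -⟩ := ψ.hasWeakDeriv.traces
  filter_upwards [h1, h2, Measure.ae_ne volume (0 : ℝ)] with x hx1 hx2 hx0
  refine (abs_le_of_sq_le_sq' ?_ (norm_nonneg _)).2
  rw [norm_sq]
  rcases lt_or_gt_of_ne hx0 with hx | hx
  · rw [hx2 hx]; exact norm_sq_add_primitive_le_of_nonpos h2 hx.le
  · rw [hx1 hx]; exact norm_sq_add_primitive_le_of_nonneg h1 hx.le

theorem trace_add {l : Filter ℝ} [l.NeBot] (hl : l ≤ ae volume) {f g : L2} {a b : ℂ}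
    (hf : Tendsto (fun x => f x) l (𝓝 a)) (hg : Tendsto (fun x => g x) l (𝓝 b)) :
    limUnder l (fun x => (f + g : L2) x) = a + b :=
  ((hf.add hg).congr' (hl ((Lp.coeFn_add f g).mono fun _ hx => hx.symm))).limUnder_eq

theorem trace_smul {l : Filter ℝ} [l.NeBot] (hl : l ≤ ae volume) (c : ℂ) {f : L2} {a : ℂ}
    (hf : Tendsto (fun x => f x) l (𝓝 a)) :
    limUnder l (fun x => (c • f : L2) x) = c * a :=
  ((hf.const_mul c).congr' (hl ((Lp.coeFn_smul c f).mono fun _ hx => hx.symm))).limUnder_eq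

/-- The jump `ψ(0+) - ψ(0-)` as a bounded linear functional on the energy space. -/
def jump : Q →L[ℂ] ℂ :=
  LinearMap.mkContinuous
    { toFun := fun ψ => rightTrace ψ.fn - leftTrace ψ.fn
      map_add' := fun ψ φ => by
        have hψ := ψ.hasWeakDeriv.traces.2.2
        have hφ := φ.hasWeakDeriv.traces.2.2
        have h1 : rightTrace (ψ + φ).fn = rightTrace ψ.fn + rightTrace φ.fn :=
          trace_add rightZero_le_ae hψ.1 hφ.1
        have h2 : leftTrace (ψ + φ).fn = leftTrace ψ.fn + leftTrace φ.fn :=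
          trace_add leftZero_le_ae hψ.2 hφ.2
        rw [h1, h2]; ring
      map_smul' := fun c ψ => by
        have hψ := ψ.hasWeakDeriv.traces.2.2
        have h1 : rightTrace (c • ψ).fn = c * rightTrace ψ.fn := trace_smul rightZero_le_ae c hψ.1
        have h2 : leftTrace (c • ψ).fn = c * leftTrace ψ.fn := trace_smul leftZero_le_ae c hψ.2
        rw [h1, h2, RingHom.id_apply, smul_eq_mul]; ring }
    2 (fun ψ => by
      have := norm_sub_le (rightTrace ψ.fn) (leftTrace ψ.fn)
      have h1 := norm_rightTrace_le ψ
      have h2 := norm_leftTrace_le ψ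
      simp only [LinearMap.coe_mk, AddHom.coe_mk]
      linarith)

theorem jump_apply (ψ : Q) : jump ψ = rightTrace ψ.fn - leftTrace ψ.fn := rfl

theorem norm_jump_le (ψ : Q) : ‖jump ψ‖ ≤ 2 * ‖ψ‖ :=
  (norm_sub_le _ _).trans (by linarith [norm_rightTrace_le ψ, norm_leftTrace_le ψ])

end Q

/-- The sesquilinear form of `H_γ`. -/
def form (γ : ℝ) (v u : Q) : ℂ :=
  inner ℂ v.der u.der - (1 / γ : ℝ) * (conj (Q.jump v) * Q.jump u)

theorem inner_eq_integral (f g : L2) : inner ℂ f g = ∫ x, conj (f x) * g x := by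
  rw [L2.inner_def]
  refine integral_congr_ae (Eventually.of_forall fun x => ?_)
  simp [mul_comm]

/-- Integration by parts on the line with the origin removed. -/
theorem HasWeakDeriv.inner_add_inner {f f' g g' : L2} (hf : HasWeakDeriv f f')
    (hg : HasWeakDeriv g g') :
    inner ℂ f' g + inner ℂ f g' =
      conj (leftTrace f) * leftTrace g - conj (rightTrace f) * rightTrace g := by
  have h1 := integrable_mul_of_memLp_two (memLp_conj f') (Lp.memLp g)
  have h2 := integrable_mul_of_memLp_two (memLp_conj f) (Lp.memLp g')
  obtain ⟨hf1, hf2, -⟩ := hf.traces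
  obtain ⟨hg1, hg2, -⟩ := hg.traces
  have h3 := setIntegral_Ioi_mul_add_mul (memLp_conj f) (memLp_conj f') (Lp.memLp g) (Lp.memLp g')
    (conj_add_primitive hf1) hg1 le_rfl
  have h4 := setIntegral_Iic_mul_add_mul (memLp_conj f) (memLp_conj f') (Lp.memLp g) (Lp.memLp g')
    (conj_add_primitive hf2) hg2 le_rfl
  have h12 : Integrable fun x => conj (f' x) * g x + conj (f x) * g' x := h1.add h2
  rw [inner_eq_integral, inner_eq_integral, ← integral_add h1 h2,
    ← intervalIntegral.integral_Iic_add_Ioi (b := 0) h12.integrableOn h12.integrableOn, h3, h4]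
  simp only [intervalIntegral.integral_same, add_zero]
  ring

/-- Since `u'` takes the same value `d` on both sides of `0`, the boundary term is `d` times the
conjugate jump of `v`; the condition `a - b = -γ d` turns `d` into the jump of `u`. Only `u` has to
satisfy the boundary conditions. -/
theorem inner_eq_form {γ : ℝ} (hγ : γ ≠ 0) (v u : Q) {y : L2}
    (h : (u.fn, y) ∈ hamiltonianGraph γ) : inner ℂ v.fn y = form γ v u := by
  obtain ⟨ψ₁, ψ₂, h1, h2, h3, a, b, d, ha, hb, hd, hd', hj⟩ := h
  simp only at h1 h3 ha hb
  have e1 := h1.unique u.hasWeakDeriv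
  subst e1
  have e2 : Q.jump u = a - b := by
    rw [Q.jump_apply, rightTrace, leftTrace, ha.limUnder_eq, hb.limUnder_eq]
  have e3 : rightTrace u.der = d := hd.limUnder_eq
  have e4 : leftTrace u.der = d := hd'.limUnder_eq
  have key := v.hasWeakDeriv.inner_add_inner h2
  have hγ' : (γ : ℂ) ≠ 0 := by exact_mod_cast hγ
  rw [e3, e4] at key
  rw [form, h3, inner_neg_right, e2, hj, Q.jump_apply, map_sub]
  push_cast
  field_simp
  linear_combination -key

theorem norm_form_le {γ : ℝ} (hγ : 0 < γ) (v u : Q) :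
    ‖form γ v u‖ ≤ (1 + 4 / γ) * (‖v‖ * ‖u‖) := by
  have h1 : ‖inner ℂ v.der u.der‖ ≤ ‖v‖ * ‖u‖ :=
    (norm_inner_le_norm _ _).trans (mul_le_mul v.norm_der_le u.norm_der_le (norm_nonneg _)
      (norm_nonneg _))
  have h2 : ‖((1 / γ : ℝ) : ℂ) * (conj (Q.jump v) * Q.jump u)‖ ≤ 4 / γ * (‖v‖ * ‖u‖) := by
    rw [norm_mul, norm_mul, RCLike.norm_conj, Complex.norm_real, Real.norm_of_nonneg (by positivity)]
    have := mul_le_mul v.norm_jump_le u.norm_jump_le (norm_nonneg _) (by positivity)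
    calc 1 / γ * (‖Q.jump v‖ * ‖Q.jump u‖) ≤ 1 / γ * (2 * ‖v‖ * (2 * ‖u‖)) := by gcongr
      _ = 4 / γ * (‖v‖ * ‖u‖) := by ring
  calc _ ≤ _ := norm_sub_le _ _
    _ ≤ _ := by rw [add_mul, one_mul]; exact add_le_add h1 h2

theorem form_smul_left (γ : ℝ) (c : ℂ) (v u : Q) : form γ (c • v) u = conj c * form γ v u := by
  have h : (c • v).der = c • v.der := Q.derL.map_smul c v
  rw [form, form, h, inner_smul_left, map_smul, smul_eq_mul, map_mul]
  ring

theorem form_smul_right (γ : ℝ) (c : ℂ) (v u : Q) : form γ v (c • u) = c * form γ v u := by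
  have h : (c • u).der = c • u.der := Q.derL.map_smul c u
  rw [form, form, h, inner_smul_right, map_smul, smul_eq_mul]
  ring

theorem re_form_comm (γ : ℝ) (v u : Q) : (form γ v u).re = (form γ u v).re := by
  have : form γ v u = conj (form γ u v) := by
    rw [form, form, map_sub, inner_conj_symm, map_mul, map_mul, Complex.conj_conj,
      Complex.conj_ofReal]
    ring
  rw [this, Complex.conj_re]

theorem re_form_self (γ : ℝ) (u : Q) :
    (form γ u u).re = ‖u.der‖ ^ 2 - 1 / γ * ‖rightTrace u.fn - leftTrace u.fn‖ ^ 2 := by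
  have h : form γ u u
      = ((‖u.der‖ ^ 2 - 1 / γ * ‖rightTrace u.fn - leftTrace u.fn‖ ^ 2 : ℝ) : ℂ) := by
    rw [form, inner_self_eq_norm_sq_to_K, ← Q.jump_apply, Complex.conj_mul']
    push_cast
    rfl
  rw [h, Complex.ofReal_re]

theorem continuous_re_form_self (γ : ℝ) : Continuous fun u : Q => (form γ u u).re := by
  have h1 := Q.derL.continuous
  have h2 := Q.jump.continuous
  exact Complex.continuous_re.comp ((h1.inner h1).sub (continuous_const.mul
    ((Complex.continuous_conj.comp h2).mul h2)))

theorem HasDerivAt.re_form_self (γ : ℝ) {S : ℝ → Q} {S' : Q} {t : ℝ} (h : HasDerivAt S S' t) :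
    HasDerivAt (fun s => (form γ (S s) (S s)).re) (2 * (form γ S' (S t)).re) t := by
  have h1 : HasDerivAt (fun s => Q.derL (S s)) (Q.derL S') t :=
    (Q.derL.restrictScalars ℝ).hasFDerivAt.comp_hasDerivAt t h
  have h2 : HasDerivAt (fun s => Q.jump (S s)) (Q.jump S') t :=
    (Q.jump.restrictScalars ℝ).hasFDerivAt.comp_hasDerivAt t h
  have h3 := h1.inner ℂ h1
  have h4 : HasDerivAt (fun s => conj (Q.jump (S s))) (conj (Q.jump S')) t :=
    Complex.conjCLE.toContinuousLinearMap.hasFDerivAt.comp_hasDerivAt t h2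
  have h5 := h3.sub ((h4.mul h2).const_mul ((1 / γ : ℝ) : ℂ))
  have h6 := Complex.reCLM.hasFDerivAt.comp_hasDerivAt t h5
  refine h6.congr_deriv ?_
  -- Hermitian symmetry makes the two halves of the derivative equal in real part.
  have e := re_form_comm γ (S t) S'
  rw [two_mul]
  nth_rewrite 1 [← e]
  rw [← Complex.add_re, Complex.reCLM_apply, form, form]
  simp only [Q.derL_apply]
  congr 1
  ring

end

/-! ### Estimates for the nonlinearity and the potential energy -/

section

open Set ComplexConjugate

/-- Bernoulli's inequality for `(b / a) ^ (p + 1)`. The factor `b` compensates for the failure of `t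
↦ t ^ p` to be Lipschitz at `0` when `p < 1`. -/
theorem sub_rpow_mul_le {a b p : ℝ} (hb : 0 ≤ b) (hab : b ≤ a) (hp : 0 < p) :
    (a ^ p - b ^ p) * b ≤ (p + 1) * a ^ p * (a - b) := by
  rcases (hb.trans hab).eq_or_lt with ha | ha
  · have : b = 0 := le_antisymm (by rwa [ha]) hb
    subst this; subst ha; simp
  have h1 := one_add_mul_self_le_rpow_one_add (s := b / a - 1) (p := p + 1)
    (by linarith [div_nonneg hb ha.le]) (by linarith)
  rw [add_sub_cancel, Real.div_rpow hb ha.le, le_div_iff₀ (by positivity),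
    Real.rpow_add_one' ha.le (by linarith), Real.rpow_add_one' hb (by linarith)] at h1
  have h2 : (1 + (p + 1) * (b / a - 1)) * (a ^ p * a) = a ^ p * a - (p + 1) * a ^ p * (a - b) := by
    field_simp; ring
  have h3 : a ^ p * b ≤ a ^ p * a := by gcongr
  rw [h2] at h1
  linarith

/-- The power nonlinearity is Lipschitz on bounded sets. -/
theorem norm_rpow_smul_sub_le {p M : ℝ} (hp : 0 < p) {z w : ℂ} (hz : ‖z‖ ≤ M) (hw : ‖w‖ ≤ M) :
    ‖‖z‖ ^ p • z - ‖w‖ ^ p • w‖ ≤ (p + 2) * M ^ p * ‖z - w‖ := by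
  wlog h : ‖w‖ ≤ ‖z‖ generalizing z w
  · rw [norm_sub_rev, norm_sub_rev z w]; exact this hw hz (not_le.mp h).le
  -- The difference of powers multiplies `w`, which has the smaller modulus, as `sub_rpow_mul_le`
  -- requires.
  have e : ‖z‖ ^ p • z - ‖w‖ ^ p • w = ‖z‖ ^ p • (z - w) + (‖z‖ ^ p - ‖w‖ ^ p) • w := by
    rw [smul_sub, sub_smul]; abel
  have hpow : ‖w‖ ^ p ≤ ‖z‖ ^ p := Real.rpow_le_rpow (norm_nonneg _) h hp.le
  have hM : ‖z‖ ^ p ≤ M ^ p := Real.rpow_le_rpow (norm_nonneg _) hz hp.le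
  have hn : ‖z‖ - ‖w‖ ≤ ‖z - w‖ := norm_sub_norm_le _ _
  calc _ ≤ ‖z‖ ^ p * ‖z - w‖ + (‖z‖ ^ p - ‖w‖ ^ p) * ‖w‖ := by
        rw [e]
        refine (norm_add_le _ _).trans_eq ?_
        rw [norm_smul, norm_smul, Real.norm_of_nonneg (by positivity),
          Real.norm_of_nonneg (sub_nonneg.mpr hpow)]
    _ ≤ ‖z‖ ^ p * ‖z - w‖ + (p + 1) * ‖z‖ ^ p * (‖z‖ - ‖w‖) := by
        exact add_le_add_right (sub_rpow_mul_le (norm_nonneg _) h hp) _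
    _ ≤ ‖z‖ ^ p * ‖z - w‖ + (p + 1) * ‖z‖ ^ p * ‖z - w‖ := by gcongr
    _ = (p + 2) * ‖z‖ ^ p * ‖z - w‖ := by ring
    _ ≤ _ := by gcongr

/-- Second order Taylor estimate for `z ↦ |z|^{p+2}`. -/
theorem abs_norm_rpow_sub_le {p M : ℝ} (hp : 0 < p) {z w : ℂ} (hz : ‖z‖ ≤ M) (hw : ‖w‖ ≤ M) :
    |‖z‖ ^ (p + 2) - ‖w‖ ^ (p + 2) - (p + 2) * (conj (‖w‖ ^ p • w) * (z - w)).re|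
      ≤ (p + 2) ^ 2 * M ^ p * ‖z - w‖ ^ 2 := by
  have hM : 0 ≤ M := (norm_nonneg _).trans hz
  -- Mean value inequality on the segment for the function minus its linear part at `w`: the
  -- derivative left over is a difference of nonlinearities, already known to be Lipschitz.
  have hD : ∀ ζ ∈ segment ℝ w z, HasFDerivWithinAt
      (fun ζ : ℂ => ‖ζ‖ ^ (p + 2) - (p + 2) * innerSL ℝ (‖w‖ ^ p • w) ζ)
      ((p + 2) • innerSL ℝ (‖ζ‖ ^ p • ζ - ‖w‖ ^ p • w)) (segment ℝ w z) ζ := by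
    intro ζ _
    have h1 := hasFDerivAt_norm_rpow ζ (p := p + 2) (by linarith)
    have h2 := (innerSL ℝ (‖w‖ ^ p • w)).hasFDerivAt (x := ζ) |>.const_mul (p + 2)
    refine ((h1.sub h2).congr_fderiv ?_).hasFDerivWithinAt
    rw [map_sub, map_smul, map_smul, smul_sub, smul_smul, smul_smul, add_sub_cancel_right]
  have hB : ∀ ζ ∈ segment ℝ w z,
      ‖(p + 2) • innerSL ℝ (‖ζ‖ ^ p • ζ - ‖w‖ ^ p • w)‖ ≤ (p + 2) * ((p + 2) * M ^ p * ‖z - w‖) := by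
    intro ζ hζ
    have h1 : ‖ζ‖ ≤ M := mem_closedBall_zero_iff.mp ((convex_closedBall (0 : ℂ) M).segment_subset
      (mem_closedBall_zero_iff.mpr hw) (mem_closedBall_zero_iff.mpr hz) hζ)
    have h2 : ‖ζ - w‖ ≤ ‖z - w‖ := norm_sub_le_of_mem_segment hζ
    rw [norm_smul, innerSL_apply_norm, Real.norm_of_nonneg (by linarith)]
    have := norm_rpow_smul_sub_le hp h1 hw
    calc _ ≤ (p + 2) * ((p + 2) * M ^ p * ‖ζ - w‖) := by gcongr
      _ ≤ _ := by gcongr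
  have key := (convex_segment w z).norm_image_sub_le_of_norm_hasFDerivWithin_le hD hB
    (left_mem_segment ℝ w z) (right_mem_segment ℝ w z)
  have e : ∀ a b : ℂ, innerSL ℝ a b = (conj a * b).re := fun a b => by
    rw [innerSL_apply_apply, Complex.inner, mul_comm]
  simp only [e, Real.norm_eq_abs] at key
  convert key using 1
  · congr 1
    rw [mul_sub, Complex.sub_re]; ring
  · ring

namespace Q

theorem aestronglyMeasurable_rpow_smul (f : L2) {p : ℝ} (hp : 0 < p) :
    AEStronglyMeasurable (fun x => ‖f x‖ ^ p • f x) (volume : Measure ℝ) := by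
  have hc : Continuous fun z : ℂ => ‖z‖ ^ p • z :=
    (continuous_norm.rpow_const fun _ => Or.inr hp.le).smul continuous_id
  exact hc.comp_aestronglyMeasurable (Lp.aestronglyMeasurable f)

variable {μ : ℝ}

theorem memLp_nonlinearity (hμ : 0 < μ) (u : Q) :
    MemLp (fun x => ‖u.fn x‖ ^ (2 * μ) • u.fn x) 2 (volume : Measure ℝ) := by
  refine (Lp.memLp u.fn).of_le_mul (c := ‖u‖ ^ (2 * μ))
    (aestronglyMeasurable_rpow_smul u.fn (by linarith)) (u.ae_norm_le.mono fun x hx => ?_)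
  rw [norm_smul, Real.norm_of_nonneg (by positivity)]
  gcongr

theorem coeFn_nonlinearity (hμ : 0 < μ) (u : Q) :
    nonlinearity μ u.fn =ᵐ[volume] fun x => ‖u.fn x‖ ^ (2 * μ) • u.fn x := by
  rw [nonlinearity, dif_pos (memLp_nonlinearity hμ u)]
  exact MemLp.coeFn_toLp _

/-- The nonlinearity is locally Lipschitz from the energy space, even for the `L²` distance. -/
theorem norm_nonlinearity_sub_le (hμ : 0 < μ) {M : ℝ} {u v : Q} (hu : ‖u‖ ≤ M) (hv : ‖v‖ ≤ M) :
    ‖nonlinearity μ u.fn - nonlinearity μ v.fn‖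
      ≤ (2 * μ + 2) * M ^ (2 * μ) * ‖u.fn - v.fn‖ := by
  refine Lp.norm_le_mul_norm_of_ae_le_mul ?_
  filter_upwards [coeFn_nonlinearity hμ u, coeFn_nonlinearity hμ v, u.ae_norm_le, v.ae_norm_le,
    Lp.coeFn_sub (nonlinearity μ u.fn) (nonlinearity μ v.fn), Lp.coeFn_sub u.fn v.fn]
    with x h1 h2 h3 h4 h5 h6
  rw [h5, h6, Pi.sub_apply, Pi.sub_apply, h1, h2]
  exact norm_rpow_smul_sub_le (by linarith) (h3.trans hu) (h4.trans hv)

/-- The potential energy integral `∫ |ψ|^{2μ+2}`. -/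
def potential (μ : ℝ) (u : Q) : ℝ := ∫ x, ‖u.fn x‖ ^ (2 * μ + 2)

theorem integrable_potential (hμ : 0 < μ) (u : Q) :
    Integrable fun x => ‖u.fn x‖ ^ (2 * μ + 2) := by
  have hc : Continuous fun z : ℂ => ‖z‖ ^ (2 * μ + 2) :=
    continuous_norm.rpow_const fun _ => Or.inr (by linarith)
  refine Integrable.mono' ((integrable_norm_sq u.fn).const_mul (‖u‖ ^ (2 * μ)))
    (hc.comp_aestronglyMeasurable (Lp.aestronglyMeasurable u.fn)) (u.ae_norm_le.mono fun x hx => ?_)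
  rw [Real.norm_of_nonneg (by positivity), Real.rpow_add_of_nonneg (norm_nonneg _) (by linarith)
    (by norm_num), Real.rpow_two]
  gcongr

/-- The pointwise Taylor estimate is integrated, with the Sobolev bound as `M`. The remainder
involves only the `L²` distance, the one for which a rate in time is available. -/
theorem abs_potential_sub_le (hμ : 0 < μ) {M : ℝ} {u v : Q} (hu : ‖u‖ ≤ M) (hv : ‖v‖ ≤ M) :
    |potential μ u - potential μ v
        - (2 * μ + 2) * (inner ℂ (nonlinearity μ v.fn) (u.fn - v.fn)).re|
      ≤ (2 * μ + 2) ^ 2 * M ^ (2 * μ) * ‖u.fn - v.fn‖ ^ 2 := by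
  have hi : Integrable fun x => conj (nonlinearity μ v.fn x) * (u.fn - v.fn : L2) x :=
    integrable_mul_of_memLp_two (memLp_conj _) (Lp.memLp _)
  have hre : (inner ℂ (nonlinearity μ v.fn) (u.fn - v.fn)).re
      = ∫ x, (conj (nonlinearity μ v.fn x) * (u.fn - v.fn : L2) x).re := by
    rw [inner_eq_integral]
    exact (integral_re hi).symm
  have hi' : Integrable fun x =>
      (2 * μ + 2) * (conj (nonlinearity μ v.fn x) * (u.fn - v.fn : L2) x).re := hi.re.const_mul _
  have hd : Integrable fun x => ‖u.fn x‖ ^ (2 * μ + 2) - ‖v.fn x‖ ^ (2 * μ + 2) :=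
    (integrable_potential hμ u).sub (integrable_potential hμ v)
  rw [potential, potential, hre, ← integral_const_mul, ← integral_sub (integrable_potential hμ u)
    (integrable_potential hμ v), ← integral_sub hd hi', norm_sq_eq_integral, ← integral_const_mul,
    ← Real.norm_eq_abs]
  refine norm_integral_le_of_norm_le ((integrable_norm_sq _).const_mul _) ?_
  filter_upwards [coeFn_nonlinearity hμ v, u.ae_norm_le, v.ae_norm_le, Lp.coeFn_sub u.fn v.fn]
    with x h2 h3 h4 h6
  rw [h6, Pi.sub_apply, h2, Real.norm_eq_abs]
  exact abs_norm_rpow_sub_le (by linarith) (h3.trans hu) (h4.trans hv)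

theorem im_inner_nonlinearity (hμ : 0 < μ) (u : Q) :
    (inner ℂ u.fn (nonlinearity μ u.fn)).im = 0 := by
  have h : inner ℂ u.fn (nonlinearity μ u.fn)
      = ((∫ x, ‖u.fn x‖ ^ (2 * μ) * ‖u.fn x‖ ^ 2 : ℝ) : ℂ) := by
    rw [inner_eq_integral, ← integral_complex_ofReal]
    refine integral_congr_ae ((coeFn_nonlinearity hμ u).mono fun x hx => ?_)
    simp only at hx ⊢
    rw [hx, Complex.real_smul, mul_left_comm, Complex.conj_mul']
    push_cast
    rfl
  rw [h, Complex.ofReal_im]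

theorem continuous_nonlinearity (hμ : 0 < μ) : Continuous fun u : Q => nonlinearity μ u.fn := by
  rw [continuous_iff_continuousAt]
  intro v
  rw [ContinuousAt, tendsto_iff_norm_sub_tendsto_zero]
  have h1 : Tendsto (fun u : Q => (2 * μ + 2) * (‖v‖ + 1) ^ (2 * μ) * ‖u.fn - v.fn‖) (𝓝 v) (𝓝 0) := by
    have := (tendsto_iff_norm_sub_tendsto_zero.mp (fnL.continuous.tendsto v)).const_mul
      ((2 * μ + 2) * (‖v‖ + 1) ^ (2 * μ))
    simpa [fnL_apply] using this
  refine squeeze_zero' (Eventually.of_forall fun _ => norm_nonneg _) ?_ h1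
  filter_upwards [continuous_norm.continuousAt.eventually_le_const (lt_add_one ‖v‖)] with u hu
  exact norm_nonlinearity_sub_le hμ hu (by linarith)

theorem continuous_potential (hμ : 0 < μ) : Continuous (potential μ) := by
  rw [continuous_iff_continuousAt]
  intro v
  rw [ContinuousAt, tendsto_iff_norm_sub_tendsto_zero]
  have h0 : Tendsto (fun u : Q => u.fn - v.fn) (𝓝 v) (𝓝 0) :=
    tendsto_sub_nhds_zero_iff.mpr (fnL.continuous.tendsto v)
  have h1 : Tendsto (fun u : Q => (2 * μ + 2) ^ 2 * (‖v‖ + 1) ^ (2 * μ) * ‖u.fn - v.fn‖ ^ 2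
      + (2 * μ + 2) * (‖nonlinearity μ v.fn‖ * ‖u.fn - v.fn‖)) (𝓝 v) (𝓝 0) := by
    have := ((h0.norm.pow 2).const_mul ((2 * μ + 2) ^ 2 * (‖v‖ + 1) ^ (2 * μ))).add
      ((h0.norm.const_mul ‖nonlinearity μ v.fn‖).const_mul (2 * μ + 2))
    simpa using this
  refine squeeze_zero' (Eventually.of_forall fun _ => norm_nonneg _) ?_ h1
  filter_upwards [continuous_norm.continuousAt.eventually_le_const (lt_add_one ‖v‖)] with u hu
  have h2 := abs_potential_sub_le hμ hu (v := v) (by linarith)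
  have h3 : |(inner ℂ (nonlinearity μ v.fn) (u.fn - v.fn)).re|
      ≤ ‖nonlinearity μ v.fn‖ * ‖u.fn - v.fn‖ :=
    (Complex.abs_re_le_norm _).trans (norm_inner_le_norm _ _)
  rw [Real.norm_eq_abs]
  rw [abs_le] at h2 h3 ⊢
  have h4 : (0 : ℝ) ≤ 2 * μ + 2 := by linarith
  constructor <;> nlinarith [mul_le_mul_of_nonneg_left h3.1 h4, mul_le_mul_of_nonneg_left h3.2 h4]

end Q

end

/-! ### Mild solutions for an abstract unitary group -/

section

namespace IsUnitaryGroup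

variable {E : Type*} [NormedAddCommGroup E] [InnerProductSpace ℂ E] [CompleteSpace E]
  {A : E →ₗ.[ℂ] E} {U : ℝ → E →L[ℂ] E}

theorem inner_apply_apply (hU : IsUnitaryGroup A U) (t : ℝ) (x y : E) :
    inner ℂ (U t x) (U t y) = inner ℂ x y :=
  ContinuousLinearMap.inner_map_map_of_mem_unitary (hU.unitary t) x y

theorem norm_apply (hU : IsUnitaryGroup A U) (t : ℝ) (x : E) : ‖U t x‖ = ‖x‖ :=
  ContinuousLinearMap.norm_map_of_mem_unitary (hU.unitary t) x

theorem add_apply (hU : IsUnitaryGroup A U) (s t : ℝ) (x : E) : U (s + t) x = U s (U t x) := by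
  rw [hU.add, mul_apply_eq_comp]

theorem apply_neg_apply (hU : IsUnitaryGroup A U) (t : ℝ) (x : E) : U t (U (-t) x) = x := by
  rw [← hU.add_apply, add_neg_cancel, hU.zero, one_apply_eq_self]

theorem continuous_uncurry (hU : IsUnitaryGroup A U) : Continuous fun p : ℝ × E => U p.1 p.2 := by
  rw [continuous_iff_continuousAt]
  rintro ⟨t, x⟩
  rw [ContinuousAt, tendsto_iff_norm_sub_tendsto_zero]
  have h1 : Tendsto (fun p : ℝ × E => ‖p.2 - x‖ + ‖U p.1 x - U t x‖) (𝓝 (t, x)) (𝓝 0) := by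
    have hc : Continuous fun p : ℝ × E => ‖p.2 - x‖ + ‖U p.1 x - U t x‖ :=
      ((continuous_snd.sub continuous_const).norm).add
        ((((hU.continuous x).comp continuous_fst).sub continuous_const).norm)
    simpa using hc.tendsto (t, x)
  refine squeeze_zero (fun _ => norm_nonneg _) (fun p => ?_) h1
  have e : U p.1 p.2 - U t x = U p.1 (p.2 - x) + (U p.1 x - U t x) := by rw [map_sub]; abel
  rw [e]
  exact (norm_add_le _ _).trans (by rw [hU.norm_apply])

/-- The mild solution `U(t) x₀ + ∫₀ᵗ U(t-s) f(s) ds` of the inhomogeneous equation. -/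
def mild (U : ℝ → E →L[ℂ] E) (x₀ : E) (f : ℝ → E) (t : ℝ) : E :=
  U t x₀ + ∫ s in (0 : ℝ)..t, U (t - s) (f s)

/-- The mild solution in the interaction picture. -/
def interaction (U : ℝ → E →L[ℂ] E) (x₀ : E) (f : ℝ → E) (t : ℝ) : E :=
  x₀ + ∫ s in (0 : ℝ)..t, U (-s) (f s)

variable {f : ℝ → E}

theorem continuous_neg_apply (hU : IsUnitaryGroup A U) (hf : Continuous f) :
    Continuous fun s => U (-s) (f s) :=
  hU.continuous_uncurry.comp (continuous_neg.prodMk hf)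

theorem mild_eq (hU : IsUnitaryGroup A U) (hf : Continuous f) (x₀ : E) (t : ℝ) :
    mild U x₀ f t = U t (interaction U x₀ f t) := by
  rw [mild, interaction, map_add, ← ContinuousLinearMap.intervalIntegral_comp_comm (U t)
    ((hU.continuous_neg_apply hf).intervalIntegrable _ _)]
  simp only [sub_eq_add_neg, hU.add_apply]

/-- The integrand is continuous, so no domain condition is needed, although the mild solution itself
may fail to be differentiable. -/
theorem hasDerivAt_interaction (hU : IsUnitaryGroup A U) (hf : Continuous f) (x₀ : E) (t : ℝ) :
    HasDerivAt (interaction U x₀ f) (U (-t) (f t)) t :=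
  ((hU.continuous_neg_apply hf).integral_hasStrictDerivAt 0 t).hasDerivAt.const_add x₀

theorem continuous_mild (hU : IsUnitaryGroup A U) (hf : Continuous f) (x₀ : E) :
    Continuous (mild U x₀ f) := by
  have h : Continuous (interaction U x₀ f) := continuous_iff_continuousAt.mpr fun t =>
    (hU.hasDerivAt_interaction hf x₀ t).continuousAt
  rw [funext (hU.mild_eq hf x₀)]
  exact hU.continuous_uncurry.comp (continuous_id.prodMk h)

/-- Evolving freely for a time `τ` misses exactly the contribution of the source on `[s, s + τ]`. -/
theorem apply_mild (hU : IsUnitaryGroup A U) (hf : Continuous f) (x₀ : E) (s τ : ℝ) :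
    U τ (mild U x₀ f s)
      = mild U x₀ f (s + τ) - U τ (∫ r in (0 : ℝ)..τ, U (-r) (f (s + r))) := by
  have hi : ∀ a b : ℝ, IntervalIntegrable (fun s => U (-s) (f s)) volume a b := fun a b =>
    (hU.continuous_neg_apply hf).intervalIntegrable a b
  have hi' : IntervalIntegrable (fun r => U (-r) (f (s + r))) volume 0 τ :=
    (hU.continuous_neg_apply (hf.comp (continuous_const.add continuous_id))).intervalIntegrable _ _
  have h1 : interaction U x₀ f (s + τ)
      = interaction U x₀ f s + U (-s) (∫ r in (0 : ℝ)..τ, U (-r) (f (s + r))) := by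
    rw [interaction, interaction, ← intervalIntegral.integral_add_adjacent_intervals (hi 0 s)
      (hi s (s + τ)), add_assoc, ← ContinuousLinearMap.intervalIntegral_comp_comm (U (-s)) hi']
    congr 2
    have := intervalIntegral.integral_comp_add_left (a := 0) (b := τ) (fun r => U (-r) (f r)) s
    rw [add_zero] at this
    rw [← this]
    simp only [neg_add, hU.add_apply]
  rw [hU.mild_eq hf, hU.mild_eq hf, h1, map_add, ← hU.add_apply, add_comm τ s, ← hU.add_apply (s + τ),
    add_neg_cancel_comm, add_sub_cancel_right]

/-- Time integrals of a mild solution lie in the domain of the generator, and the equation holds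
for them in the strong sense. -/
theorem integral_mild_mem_graph (hU : IsUnitaryGroup A U) (hf : Continuous f) (x₀ : E) (a b : ℝ) :
    (∫ s in a..b, mild U x₀ f s,
      Complex.I • (mild U x₀ f b - mild U x₀ f a - ∫ s in a..b, f s)) ∈ A.graph := by
  rw [hU.generator, smul_smul, Complex.I_mul_I, neg_one_smul, neg_neg]
  set w := mild U x₀ f with hw
  have hwc : Continuous w := hU.continuous_mild hf x₀
  set k : ℝ → E := fun r => ∫ s in a..b, U (-r) (f (s + r)) with hk
  have hc2 : Continuous fun p : ℝ × ℝ => U (-p.1) (f (p.2 + p.1)) :=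
    hU.continuous_uncurry.comp ((continuous_neg.comp continuous_fst).prodMk
      (hf.comp (continuous_snd.add continuous_fst)))
  have hkc : Continuous k := intervalIntegral.continuous_parametric_intervalIntegral_of_continuous' hc2 a b
  -- Integrating `apply_mild` over `s` moves the shift by `τ` into the endpoints, where it is
  -- differentiable.
  have hformula : ∀ τ, U τ (∫ s in a..b, w s)
      = (∫ s in (0 : ℝ)..(b + τ), w s) - (∫ s in (0 : ℝ)..(a + τ), w s)
        - U τ (∫ r in (0 : ℝ)..τ, k r) := by
    intro τ
    have hci : Continuous fun s => ∫ r in (0 : ℝ)..τ, U (-r) (f (s + r)) :=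
      intervalIntegral.continuous_parametric_intervalIntegral_of_continuous'
        (f := fun s r => U (-r) (f (s + r)))
        (hc2.comp (continuous_snd.prodMk continuous_fst)) 0 τ
    have hswap : ∫ s in a..b, ∫ r in (0 : ℝ)..τ, U (-r) (f (s + r)) = ∫ r in (0 : ℝ)..τ, k r := by
      refine intervalIntegral_intervalIntegral_swap ?_
      exact ((hc2.comp (continuous_snd.prodMk continuous_fst)).continuousOn.integrableOn_compact
        (isCompact_uIcc.prod isCompact_uIcc)).mono_set
        (Set.prod_mono Set.uIoc_subset_uIcc Set.uIoc_subset_uIcc)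
    have hi1 : IntervalIntegrable (fun s => w (s + τ)) volume a b :=
      (hwc.comp (continuous_id.add continuous_const)).intervalIntegrable _ _
    have hi2 : IntervalIntegrable (fun s => U τ (∫ r in (0 : ℝ)..τ, U (-r) (f (s + r)))) volume a b :=
      ((U τ).continuous.comp hci).intervalIntegrable _ _
    rw [← ContinuousLinearMap.intervalIntegral_comp_comm (U τ) (hwc.intervalIntegrable _ _)]
    simp only [hw, hU.apply_mild hf]
    rw [← hw, intervalIntegral.integral_sub hi1 hi2,
      ContinuousLinearMap.intervalIntegral_comp_comm (U τ) (hci.intervalIntegrable _ _), hswap,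
      intervalIntegral.integral_comp_add_right,
      intervalIntegral.integral_interval_sub_left (hwc.intervalIntegrable _ _)
        (hwc.intervalIntegrable _ _)]
  have hshift : ∀ c : ℝ, HasDerivAt (fun τ => ∫ s in (0 : ℝ)..(c + τ), w s) (w c) 0 := by
    intro c
    have h1 := (hwc.integral_hasStrictDerivAt 0 (c + 0)).hasDerivAt
    have := h1.comp_const_add c 0
    simpa using this
  -- The inner integral vanishes at `τ = 0`, so the slope is `U τ` applied to an average tending to
  -- `k 0`; joint continuity suffices.
  have hprod : HasDerivAt (fun τ => U τ (∫ r in (0 : ℝ)..τ, k r)) (∫ s in a..b, f s) 0 := by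
    have h0 : k 0 = ∫ s in a..b, f s := by
      simp [hk, hU.zero]
    have h1 := (hkc.integral_hasStrictDerivAt 0 0).hasDerivAt
    rw [hasDerivAt_iff_tendsto_slope_zero] at h1 ⊢
    have h2 : Tendsto (fun τ : ℝ => τ) (𝓝[≠] 0) (𝓝 0) := tendsto_id.mono_left nhdsWithin_le_nhds
    have h3 := (hU.continuous_uncurry.tendsto (0, k 0)).comp (h2.prodMk_nhds h1)
    simp only [hU.zero, one_apply_eq_self, h0] at h3
    refine h3.congr fun τ => ?_
    simp [hU.zero]
  refine (((hshift b).sub (hshift a)).sub hprod).congr_of_eventuallyEq ?_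
  exact Eventually.of_forall hformula

/-- If the source is orthogonal to the mild solution in real part, the norm is conserved. -/
theorem norm_mild (hU : IsUnitaryGroup A U) (hf : Continuous f) (x₀ : E) {b : ℝ} (hb : 0 ≤ b)
    (h : ∀ t ∈ Set.Icc 0 b, (inner ℂ (mild U x₀ f t) (f t)).re = 0) :
    ‖mild U x₀ f b‖ = ‖x₀‖ := by
  set φ := interaction U x₀ f with hφ
  have hd : ∀ t ∈ Set.Icc 0 b, HasDerivAt (fun t => (inner ℂ (φ t) (φ t)).re) 0 t := by
    intro t ht
    have h1 := hU.hasDerivAt_interaction hf x₀ t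
    have h2 := Complex.reCLM.hasFDerivAt.comp_hasDerivAt t (h1.inner ℂ h1)
    refine h2.congr_deriv ?_
    have h3 : (inner ℂ (φ t) (U (-t) (f t))).re = 0 := by
      rw [← hU.inner_apply_apply t, hU.apply_neg_apply, ← hU.mild_eq hf]
      exact h t ht
    have h4 : (inner ℂ (U (-t) (f t)) (φ t)).re = 0 := by
      rw [← inner_conj_symm, Complex.conj_re, h3]
    rw [Complex.reCLM_apply, Complex.add_re, ← hφ, h3, h4, add_zero]
  have hconst := constant_of_has_deriv_right_zero
    (fun t ht => (hd t ht).continuousAt.continuousWithinAt)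
    (fun t ht => (hd t ⟨ht.1, ht.2.le⟩).hasDerivWithinAt) b ⟨hb, le_rfl⟩
  have h0 : φ 0 = x₀ := by simp [hφ, interaction]
  rw [h0] at hconst
  rw [hU.mild_eq hf, hU.norm_apply, @norm_eq_sqrt_re_inner ℂ, @norm_eq_sqrt_re_inner ℂ E _ _ _ x₀]
  exact congrArg Real.sqrt hconst

end IsUnitaryGroup

end

/-! ### Completeness of the energy space and Steklov averages -/

theorem continuous_integral_test_smul {φ : ℝ → ℝ} (hφ : Continuous φ) (hc : HasCompactSupport φ) :
    Continuous fun f : L2 => ∫ x, φ x • f x := by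
  have hm : MemLp (fun x => (φ x : ℂ)) 2 (volume : Measure ℝ) :=
    (Complex.continuous_ofReal.comp hφ).memLp_of_hasCompactSupport
      (hc.comp_left (g := Complex.ofReal) Complex.ofReal_zero)
  have e : (fun f : L2 => ∫ x, φ x • f x) = fun f => inner ℂ hm.toLp f := by
    ext f
    rw [inner_eq_integral]
    refine integral_congr_ae (hm.coeFn_toLp.mono fun x hx => ?_)
    simp only
    rw [hx, Complex.conj_ofReal, Complex.real_smul]
  rw [e]
  exact continuous_const.inner continuous_id

/-- Each defining identity is an equality of continuous functionals. The resulting completeness of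
`Q` is needed for integrals of `Q`-valued functions. -/
theorem isClosed_energySpace : IsClosed (energySpace : Set (WithLp 2 (L2 × L2))) := by
  have e : (energySpace : Set (WithLp 2 (L2 × L2))) =
      {p | ∀ φ : ℝ → ℝ, ContDiff ℝ ∞ φ → HasCompactSupport φ → tsupport φ ⊆ {0}ᶜ →
        ∫ x, deriv φ x • p.fst x = -∫ x, φ x • p.snd x} := rfl
  rw [e]
  simp only [Set.ofPred_forall]
  refine isClosed_iInter fun φ => isClosed_iInter fun hφ => isClosed_iInter fun hc =>
    isClosed_iInter fun _ => isClosed_eq ?_ ?_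
  · exact (continuous_integral_test_smul (hφ.continuous_deriv (by simp)) hc.deriv).comp
      (WithLp.fstL 2 ℂ L2 L2).continuous
  · exact ((continuous_integral_test_smul hφ.continuous hc).comp
      (WithLp.sndL 2 ℂ L2 L2).continuous).neg

instance completeSpace_Q : CompleteSpace Q :=
  isClosed_energySpace.completeSpace_coe

theorem Q.ext_fn {u v : Q} (h : u.fn = v.fn) : u = v := by
  have h2 : u.der = v.der := HasWeakDeriv.unique u.hasWeakDeriv (by rw [h]; exact v.hasWeakDeriv)
  refine Subtype.ext (WithLp.ofLp_injective 2 (Prod.ext h h2))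

theorem energy_eq (γ l μ : ℝ) (u : Q) :
    energy γ l μ u = 1 / 2 * (form γ u u).re - l / (2 * μ + 2) * Q.potential μ u := by
  rw [energy, re_form_self, Q.potential]
  ring

section Average

variable {E : Type*} [NormedAddCommGroup E] [NormedSpace ℝ E] [CompleteSpace E] {g : ℝ → E}

theorem hasDerivAt_integral_shift (hg : Continuous g) (h t : ℝ) :
    HasDerivAt (fun s => ∫ r in s..(s + h), g r) (g (t + h) - g t) t := by
  have h1 := (hg.integral_hasStrictDerivAt 0 (t + h)).hasDerivAt.comp_add_const t h
  have h2 := (hg.integral_hasStrictDerivAt 0 t).hasDerivAt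
  refine (h1.sub h2).congr_of_eventuallyEq (Eventually.of_forall fun s => ?_)
  exact (intervalIntegral.integral_interval_sub_left (hg.intervalIntegrable _ _)
    (hg.intervalIntegrable _ _)).symm

theorem tendsto_inv_smul_integral (hg : Continuous g) (t : ℝ) :
    Tendsto (fun h : ℝ => h⁻¹ • ∫ r in t..(t + h), g r) (𝓝[>] 0) (𝓝 (g t)) := by
  have h1 := (hasDerivAt_iff_tendsto_slope_zero.mp
    (hg.integral_hasStrictDerivAt t t).hasDerivAt).mono_left (nhdsGT_le_nhdsNE 0)
  simpa using h1

end Average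

/-! ### Conservation of the averaged energy and passage to the limit -/

variable {γ l μ : ℝ} {U : ℝ → L2 →L[ℂ] L2} {u₀ : L2} {Ψ : ℝ → Q} {b : ℝ}

/-- The equation satisfied by time integrals of a mild solution, tested against the energy
space. -/
theorem form_integral_eq (hγ : γ ≠ 0) (hμ : 0 < μ) (hU : IsUnitaryGroup (hamiltonian γ) U)
    (hΨ : Continuous Ψ)
    (hsol : ∀ t ∈ Set.Icc 0 b, (Ψ t).fn
      = IsUnitaryGroup.mild U u₀ (fun s => (Complex.I * l) • nonlinearity μ (Ψ s).fn) t)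
    {a c : ℝ} (ha : a ∈ Set.Icc 0 b) (hc : c ∈ Set.Icc 0 b) (v : Q) :
    form γ v (∫ s in a..c, Ψ s) = Complex.I * inner ℂ v.fn (Ψ c - Ψ a).fn
      + l * inner ℂ v.fn (∫ s in a..c, nonlinearity μ (Ψ s).fn) := by
  have hN : Continuous fun s => nonlinearity μ (Ψ s).fn := (Q.continuous_nonlinearity hμ).comp hΨ
  have hN' : Continuous fun s => (Complex.I * l) • nonlinearity μ (Ψ s).fn :=
    (continuous_const_smul (Complex.I * (l : ℂ))).comp hN
  set w := IsUnitaryGroup.mild U u₀ (fun s => (Complex.I * l) • nonlinearity μ (Ψ s).fn) with hw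
  have hmem : (∫ s in a..c, w s, Complex.I • (w c - w a
      - ∫ s in a..c, (Complex.I * l) • nonlinearity μ (Ψ s).fn)) ∈ (hamiltonian γ).graph :=
    hU.integral_mild_mem_graph hN' u₀ a c
  -- The inclusion in `L²` commutes with the integral, so the integral taken in `Q` represents the
  -- element of the domain.
  have hint : ∫ s in a..c, w s = (∫ s in a..c, Ψ s).fn := by
    rw [← Q.fnL_apply, ← ContinuousLinearMap.intervalIntegral_comp_comm Q.fnL
      (hΨ.intervalIntegrable _ _)]
    refine intervalIntegral.integral_congr fun s hs => ?_
    exact (hsol s (Set.uIcc_subset_Icc ha hc hs)).symm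
  rw [hint, hamiltonian_graph, ← hsol a ha, ← hsol c hc, intervalIntegral.integral_smul] at hmem
  have hsub : (Ψ c - Ψ a).fn = (Ψ c).fn - (Ψ a).fn := Q.fnL.map_sub _ _
  rw [← inner_eq_form hγ v _ hmem, ← hsub, smul_sub, inner_sub_right, inner_smul_right,
    inner_smul_right, inner_smul_right, ← mul_assoc Complex.I, ← mul_assoc Complex.I,
    Complex.I_mul_I]
  ring

/-- A mild solution which is bounded in the energy space is Hölder continuous of exponent `1/2` in
`L²`, with a constant controlled by the modulus of continuity in the energy space. -/
theorem norm_fn_sub_sq_le (hγ : 0 < γ) (hl : 0 < l) (hμ : 0 < μ)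
    (hU : IsUnitaryGroup (hamiltonian γ) U) (hΨ : Continuous Ψ)
    (hsol : ∀ t ∈ Set.Icc 0 b, (Ψ t).fn
      = IsUnitaryGroup.mild U u₀ (fun s => (Complex.I * l) • nonlinearity μ (Ψ s).fn) t)
    {M : ℝ} (hM : ∀ s, ‖Ψ s‖ ≤ M) (hM' : ∀ s, ‖nonlinearity μ (Ψ s).fn‖ ≤ M)
    {a c : ℝ} (ha : 0 ≤ a) (hac : a ≤ c) (hc : c ≤ b) :
    ‖(Ψ c - Ψ a).fn‖ ^ 2 ≤ (1 + 4 / γ + l) * M * (c - a) * ‖Ψ c - Ψ a‖ := by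
  -- Testing with the increment itself produces `i‖v‖²`; the other terms carry a factor `c - a` from
  -- the time integrals.
  set v := Ψ c - Ψ a
  have h1 := form_integral_eq hγ.ne' hμ hU hΨ hsol ⟨ha, hac.trans hc⟩ ⟨ha.trans hac, hc⟩ v
  have hca : |c - a| = c - a := abs_of_nonneg (by linarith)
  have h2 : ‖∫ s in a..c, Ψ s‖ ≤ M * (c - a) := by
    rw [← hca]; exact intervalIntegral.norm_integral_le_of_norm_le_const fun s _ => hM s
  have h3 : ‖∫ s in a..c, nonlinearity μ (Ψ s).fn‖ ≤ M * (c - a) := by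
    rw [← hca]; exact intervalIntegral.norm_integral_le_of_norm_le_const fun s _ => hM' s
  have h4 : Complex.I * inner ℂ v.fn v.fn = form γ v (∫ s in a..c, Ψ s)
      - l * inner ℂ v.fn (∫ s in a..c, nonlinearity μ (Ψ s).fn) := by rw [h1]; ring
  have h5 : ‖Complex.I * inner ℂ v.fn v.fn‖ = ‖v.fn‖ ^ 2 := by
    rw [norm_mul, Complex.norm_I, one_mul, inner_self_eq_norm_sq_to_K]
    simp
  have h6 : ‖(l : ℂ) * inner ℂ v.fn (∫ s in a..c, nonlinearity μ (Ψ s).fn)‖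
      ≤ l * (‖v‖ * (M * (c - a))) := by
    rw [norm_mul, Complex.norm_real, Real.norm_of_nonneg hl.le]
    gcongr
    exact (norm_inner_le_norm _ _).trans (mul_le_mul v.norm_fn_le h3 (norm_nonneg _) (norm_nonneg _))
  have h7 : ‖form γ v (∫ s in a..c, Ψ s)‖ ≤ (1 + 4 / γ) * (‖v‖ * (M * (c - a))) :=
    (norm_form_le hγ _ _).trans (by gcongr)
  rw [← h5, h4]
  calc _ ≤ _ := norm_sub_le _ _
    _ ≤ (1 + 4 / γ) * (‖v‖ * (M * (c - a))) + l * (‖v‖ * (M * (c - a))) := add_le_add h7 h6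
    _ = _ := by ring

theorem re_form_real_smul (γ : ℝ) (r : ℝ) (v u : Q) :
    (form γ (r • v) (r • u)).re = r ^ 2 * (form γ v u).re := by
  have h : ∀ w : Q, r • w = (r : ℂ) • w := fun w => (Complex.coe_smul r w).symm
  rw [h, h, form_smul_left, form_smul_right, Complex.conj_ofReal, ← mul_assoc, ← Complex.ofReal_mul,
    Complex.re_ofReal_mul, sq]

/-- The energy of the Steklov average of `Ψ`, with the potential part averaged separately. -/
def averagedEnergy (γ l μ : ℝ) (Ψ : ℝ → Q) (h t : ℝ) : ℝ :=
  1 / 2 * (form γ (h⁻¹ • ∫ r in t..(t + h), Ψ r) (h⁻¹ • ∫ r in t..(t + h), Ψ r)).re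
    - l / (2 * μ + 2) * (h⁻¹ • ∫ r in t..(t + h), Q.potential μ (Ψ r))

theorem tendsto_averagedEnergy (γ l : ℝ) (hμ : 0 < μ) (hΨ : Continuous Ψ) (t : ℝ) :
    Tendsto (fun h => averagedEnergy γ l μ Ψ h t) (𝓝[>] 0) (𝓝 (energy γ l μ (Ψ t))) := by
  rw [energy_eq]
  have h1 := ((continuous_re_form_self γ).tendsto (Ψ t)).comp (tendsto_inv_smul_integral hΨ t)
  have h2 := tendsto_inv_smul_integral ((Q.continuous_potential hμ).comp hΨ) t
  exact (h1.const_mul _).sub (h2.const_mul _)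

/-- Averaging the potential, rather than evaluating it at the average, makes its derivative a
difference quotient to which the Taylor estimate applies. -/
theorem hasDerivAt_averagedEnergy (γ l : ℝ) (hμ : 0 < μ) (hΨ : Continuous Ψ) (h t : ℝ) :
    HasDerivAt (averagedEnergy γ l μ Ψ h)
      (h⁻¹ ^ 2 * (form γ (Ψ (t + h) - Ψ t) (∫ r in t..(t + h), Ψ r)).re
        - l / (2 * μ + 2) * (h⁻¹ * (Q.potential μ (Ψ (t + h)) - Q.potential μ (Ψ t)))) t := by
  have h1 := HasDerivAt.re_form_self γ ((hasDerivAt_integral_shift hΨ h t).fun_const_smul h⁻¹)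
  have h2 := (hasDerivAt_integral_shift ((Q.continuous_potential hμ).comp hΨ) h t).fun_const_smul h⁻¹
  refine ((h1.const_mul (1 / 2)).sub (h2.const_mul (l / (2 * μ + 2)))).congr_deriv ?_
  rw [re_form_real_smul, smul_eq_mul]
  simp only [Function.comp_apply]
  ring

/-- The averaged energy varies slowly as soon as the averaging step is below the modulus of
continuity of the solution. -/
theorem abs_deriv_averagedEnergy_le (hγ : 0 < γ) (hl : 0 < l) (hμ : 0 < μ)
    (hU : IsUnitaryGroup (hamiltonian γ) U) (hΨ : Continuous Ψ)
    (hsol : ∀ t ∈ Set.Icc 0 b, (Ψ t).fn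
      = IsUnitaryGroup.mild U u₀ (fun s => (Complex.I * l) • nonlinearity μ (Ψ s).fn) t)
    {M : ℝ} (hM : ∀ s, ‖Ψ s‖ ≤ M) (hM' : ∀ s, ‖nonlinearity μ (Ψ s).fn‖ ≤ M)
    {h t ε : ℝ} (hh : 0 < h) (ht : 0 ≤ t) (hth : t + h ≤ b)
    (hε : ∀ s ∈ Set.Icc t (t + h), ‖Ψ s - Ψ t‖ ≤ ε) :
    |h⁻¹ ^ 2 * (form γ (Ψ (t + h) - Ψ t) (∫ r in t..(t + h), Ψ r)).re
        - l / (2 * μ + 2) * (h⁻¹ * (Q.potential μ (Ψ (t + h)) - Q.potential μ (Ψ t)))|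
      ≤ 2 * l * (2 * μ + 2) * M ^ (2 * μ) * ((1 + 4 / γ + l) * M) * ε := by
  set K := (1 + 4 / γ + l) * M with hK
  set L := (2 * μ + 2) * M ^ (2 * μ) with hL
  have hM0 : 0 ≤ M := (norm_nonneg _).trans (hM 0)
  have hK0 : 0 ≤ K := by positivity
  have hL0 : 0 ≤ L := by positivity
  have hε0 : 0 ≤ ε := (norm_nonneg _).trans (hε t ⟨le_rfl, by linarith⟩)
  set v := Ψ (t + h) - Ψ t with hv
  set N : ℝ → L2 := fun s => nonlinearity μ (Ψ s).fn with hN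
  have hNc : Continuous N := (Q.continuous_nonlinearity hμ).comp hΨ
  have hsub : ∀ s, (Ψ s - Ψ t).fn = (Ψ s).fn - (Ψ t).fn := fun s => Q.fnL.map_sub _ _
  have hdist : ∀ s ∈ Set.Icc t (t + h), ‖(Ψ s - Ψ t).fn‖ ≤ Real.sqrt (K * h * ε) := by
    intro s hs
    refine Real.le_sqrt_of_sq_le ?_
    have h1 := norm_fn_sub_sq_le hγ hl hμ hU hΨ hsol hM hM' ht hs.1 (hs.2.trans hth)
    refine h1.trans ?_
    have h2 : s - t ≤ h := by linarith [hs.2]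
    have h3 := hε s hs
    have h4 : 0 ≤ s - t := by linarith [hs.1]
    gcongr
  have hv1 := hdist (t + h) ⟨by linarith, le_rfl⟩
  have hS : Real.sqrt (K * h * ε) * Real.sqrt (K * h * ε) = K * h * ε :=
    Real.mul_self_sqrt (by positivity)
  set σ := Real.sqrt (K * h * ε) with hσ
  have hσ0 : 0 ≤ σ := Real.sqrt_nonneg _
  -- the averaged nonlinearity is close to the nonlinearity
  have hNd : ‖(∫ s in t..(t + h), N s) - h • N t‖ ≤ L * σ * h := by
    have e : (∫ s in t..(t + h), N s) - h • N t = ∫ s in t..(t + h), (N s - N t) := by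
      rw [intervalIntegral.integral_sub (hNc.intervalIntegrable _ _)
        (continuous_const.intervalIntegrable _ _), intervalIntegral.integral_const,
        add_sub_cancel_left]
    rw [e]
    have hb : ∀ s ∈ Set.uIoc t (t + h), ‖N s - N t‖ ≤ L * σ := by
      intro s hs
      rw [Set.uIoc_of_le (by linarith)] at hs
      refine (Q.norm_nonlinearity_sub_le hμ (hM s) (hM t)).trans ?_
      rw [← hsub]
      exact mul_le_mul_of_nonneg_left (hdist s ⟨hs.1.le, hs.2⟩) hL0
    have := intervalIntegral.norm_integral_le_of_norm_le_const hb
    rwa [add_sub_cancel_left, abs_of_pos hh] at this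
  have hsmul : h • N t = (h : ℂ) • N t := RCLike.real_smul_eq_coe_smul h (N t)
  -- Here `i‖v‖²` disappears on taking real parts.
  have hform : (form γ v (∫ r in t..(t + h), Ψ r)).re
      = l * ((inner ℂ v.fn ((∫ s in t..(t + h), N s) - h • N t)).re
        + h * (inner ℂ (N t) v.fn).re) := by
    rw [form_integral_eq hγ.ne' hμ hU hΨ hsol ⟨ht, by linarith⟩ ⟨by linarith, hth⟩ v, Complex.add_re,
      Complex.re_ofReal_mul, inner_self_eq_norm_sq_to_K, inner_sub_right, Complex.sub_re,
      hsmul, inner_smul_right, Complex.re_ofReal_mul]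
    have e1 : (Complex.I * ((‖v.fn‖ : ℝ) : ℂ) ^ 2).re = 0 := by
      rw [← Complex.ofReal_pow, Complex.re_mul_ofReal, Complex.I_re, zero_mul]
    have e2 : (inner ℂ (N t) v.fn).re = (inner ℂ v.fn (N t)).re := by
      rw [← inner_conj_symm, Complex.conj_re]
    have e3 : (Complex.I * (RCLike.ofReal ‖v.fn‖ : ℂ) ^ 2).re = 0 := e1
    rw [e2, e3]
    ring
  have hpot := Q.abs_potential_sub_le hμ (hM (t + h)) (hM t)
  rw [← hsub (t + h), ← hv] at hpot
  set R := Q.potential μ (Ψ (t + h)) - Q.potential μ (Ψ t)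
    - (2 * μ + 2) * (inner ℂ (nonlinearity μ (Ψ t).fn) v.fn).re with hR
  have hp0 : 0 < 2 * μ + 2 := by linarith
  -- The first-order terms cancel exactly. Both remainders are of size `h⁻¹ σ²`, which is `K ε`.
  have e : h⁻¹ ^ 2 * (form γ v (∫ r in t..(t + h), Ψ r)).re
        - l / (2 * μ + 2) * (h⁻¹ * (Q.potential μ (Ψ (t + h)) - Q.potential μ (Ψ t)))
      = l * h⁻¹ ^ 2 * (inner ℂ v.fn ((∫ s in t..(t + h), N s) - h • N t)).re
        - l / (2 * μ + 2) * h⁻¹ * R := by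
    rw [hform, hR]
    field_simp
    ring
  have hb1 : |(inner ℂ v.fn ((∫ s in t..(t + h), N s) - h • N t)).re| ≤ σ * (L * σ * h) :=
    (Complex.abs_re_le_norm _).trans ((norm_inner_le_norm _ _).trans
      (mul_le_mul hv1 hNd (norm_nonneg _) hσ0))
  have hb2 : |R| ≤ (2 * μ + 2) * L * (σ * σ) := by
    refine hpot.trans ?_
    have : ‖v.fn‖ ^ 2 ≤ σ * σ := by rw [← sq]; gcongr
    calc _ ≤ (2 * μ + 2) ^ 2 * M ^ (2 * μ) * (σ * σ) := by gcongr
      _ = _ := by rw [hL]; ring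
  rw [e]
  calc _ ≤ _ := abs_sub _ _
    _ ≤ l * h⁻¹ ^ 2 * (σ * (L * σ * h)) + l / (2 * μ + 2) * h⁻¹ * ((2 * μ + 2) * L * (σ * σ)) := by
        rw [abs_mul, abs_mul (l / (2 * μ + 2) * h⁻¹), abs_of_nonneg (by positivity),
          abs_of_nonneg (show 0 ≤ l / (2 * μ + 2) * h⁻¹ by positivity)]
        gcongr
    _ = 2 * l * h⁻¹ * L * (σ * σ) := by field_simp; ring
    _ = _ := by rw [hS, hL]; field_simp

/-- Conservation of the energy for mild solutions which are continuous in the energy space. -/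
theorem energy_eq_of_mild (hγ : 0 < γ) (hl : 0 < l) (hμ : 0 < μ)
    (hU : IsUnitaryGroup (hamiltonian γ) U) (hΨ : Continuous Ψ)
    (hsol : ∀ t ∈ Set.Icc 0 b, (Ψ t).fn
      = IsUnitaryGroup.mild U u₀ (fun s => (Complex.I * l) • nonlinearity μ (Ψ s).fn) t)
    {M : ℝ} (hM : ∀ s, ‖Ψ s‖ ≤ M) (hM' : ∀ s, ‖nonlinearity μ (Ψ s).fn‖ ≤ M)
    {t : ℝ} (ht : 0 ≤ t) (htb : t < b) :
    energy γ l μ (Ψ t) = energy γ l μ (Ψ 0) := by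
  set C := 2 * l * (2 * μ + 2) * M ^ (2 * μ) * ((1 + 4 / γ + l) * M) with hC
  have hM0 : 0 ≤ M := (norm_nonneg _).trans (hM 0)
  have hC0 : 0 ≤ C := by positivity
  have hlim := (tendsto_averagedEnergy γ l hμ hΨ t).sub (tendsto_averagedEnergy γ l hμ hΨ 0)
  have hzero : Tendsto (fun h => averagedEnergy γ l μ Ψ h t - averagedEnergy γ l μ Ψ h 0)
      (𝓝[>] 0) (𝓝 0) := by
    rw [Metric.tendsto_nhds]
    intro η hη
    -- This choice gives `C * ε * t < η`, including when `C * t = 0`.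
    set ε := η / (C * t + 1) with hεdef
    have hpos : 0 < C * t + 1 := by positivity
    have hε : 0 < ε := by positivity
    obtain ⟨δ, hδ, hδε⟩ := Metric.uniformContinuousOn_iff.mp
      (isCompact_Icc.uniformContinuousOn_of_continuous (hΨ.continuousOn (s := Set.Icc 0 b))) ε hε
    filter_upwards [Ioo_mem_nhdsGT (lt_min hδ (sub_pos.mpr htb))] with h hh
    have hhδ : h < δ := hh.2.trans_le (min_le_left _ _)
    have hhb : h < b - t := hh.2.trans_le (min_le_right _ _)
    have hbound : ∀ s ∈ Set.Ico 0 t, ‖h⁻¹ ^ 2 * (form γ (Ψ (s + h) - Ψ s) (∫ r in s..(s + h), Ψ r)).re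
        - l / (2 * μ + 2) * (h⁻¹ * (Q.potential μ (Ψ (s + h)) - Q.potential μ (Ψ s)))‖ ≤ C * ε := by
      intro s hs
      refine abs_deriv_averagedEnergy_le hγ hl hμ hU hΨ hsol hM hM' hh.1 hs.1
        (by linarith [hs.2]) fun r hr => ?_
      rw [← dist_eq_norm]
      refine (hδε r ⟨hs.1.trans hr.1, by linarith [hr.2, hs.2]⟩ s ⟨hs.1, by linarith [hs.2]⟩ ?_).le
      rw [Real.dist_eq, abs_of_nonneg (by linarith [hr.1])]
      linarith [hr.2]
    have key := norm_image_sub_le_of_norm_deriv_le_segment'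
      (fun s _ => (hasDerivAt_averagedEnergy γ l hμ hΨ h s).hasDerivWithinAt) hbound t ⟨ht, le_rfl⟩
    rw [dist_zero_right]
    refine key.trans_lt ?_
    rw [sub_zero, hεdef, mul_assoc, div_mul_eq_mul_div, mul_div_assoc', div_lt_iff₀ hpos]
    nlinarith
  exact sub_eq_zero.mp (tendsto_nhds_unique hlim hzero)

/-! ### Application to solutions on `[0, T)` -/

/-- The room to the right of `t` is where the averaging window `[t, t + h]` lives. -/
theorem timeInterval_exists_gt {T : EReal} {t : ℝ} (ht : t ∈ timeInterval T) :
    ∃ b, t < b ∧ Set.Icc 0 b ⊆ timeInterval T := by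
  obtain ⟨b, hb1, hb2⟩ := EReal.lt_iff_exists_real_btwn.mp ht.2
  exact ⟨b, by exact_mod_cast hb1, fun s hs => ⟨hs.1, (EReal.coe_le_coe_iff.mpr hs.2).trans_lt hb2⟩⟩

theorem isUnitaryGroup_unitaryGroup {E : Type*} [NormedAddCommGroup E] [InnerProductSpace ℂ E]
    [CompleteSpace E] {A : E →ₗ.[ℂ] E} (h : ∃ U, IsUnitaryGroup A U) :
    IsUnitaryGroup A (unitaryGroup A) := by
  rw [unitaryGroup, dif_pos h]
  exact h.choose_spec

/-- Conservation laws when the propagator is a genuine unitary group. -/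
theorem IsSolution.conservation (hγ : 0 < γ) (hl : 0 < l) (hμ : 0 < μ) {T : EReal} {ψ₀ : Q}
    {ψ : ℝ → Q} (hψ : IsSolution γ l μ T ψ₀ ψ)
    (hU : IsUnitaryGroup (hamiltonian γ) (unitaryGroup (hamiltonian γ)))
    {t : ℝ} (ht : t ∈ timeInterval T) :
    ‖(ψ t).fn‖ = ‖ψ₀.fn‖ ∧ energy γ l μ (ψ t) = energy γ l μ ψ₀ := by
  obtain ⟨b, htb, hb⟩ := timeInterval_exists_gt ht
  have ht0 : 0 ≤ t := ht.1
  have hb0 : 0 ≤ b := ht0.trans htb.le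
  -- Freezing `ψ` outside `[0, b]` gives a bounded continuous function on the whole line; the
  -- Duhamel formula is only used on `[0, b]`.
  set Ψ : ℝ → Q := fun s => ψ (Set.projIcc 0 b hb0 s) with hΨdef
  have heq : ∀ s ∈ Set.Icc 0 b, Ψ s = ψ s := fun s hs => by
    simp only [hΨdef, Set.projIcc_of_mem hb0 hs]
  have hΨ : Continuous Ψ := by
    have h1 : Continuous fun s : Set.Icc (0 : ℝ) b => ψ s :=
      continuousOn_iff_continuous_domRestrict.mp (hψ.continuousOn.mono hb)
    exact h1.comp continuous_projIcc
  have hbdd : ∃ M, ∀ s, ‖Ψ s‖ ≤ M ∧ ‖nonlinearity μ (Ψ s).fn‖ ≤ M := by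
    obtain ⟨M₁, h1⟩ := isCompact_Icc.exists_bound_of_continuousOn (hΨ.continuousOn (s := Set.Icc 0 b))
    obtain ⟨M₂, h2⟩ := isCompact_Icc.exists_bound_of_continuousOn
      (((Q.continuous_nonlinearity hμ).comp hΨ).continuousOn (s := Set.Icc 0 b))
    refine ⟨max M₁ M₂, fun s => ?_⟩
    have e : Ψ s = Ψ (Set.projIcc 0 b hb0 s) := (heq _ (Set.projIcc 0 b hb0 s).2).symm
    rw [e]
    exact ⟨(h1 _ (Set.projIcc 0 b hb0 s).2).trans (le_max_left _ _),
      (h2 _ (Set.projIcc 0 b hb0 s).2).trans (le_max_right _ _)⟩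
  obtain ⟨M, hM⟩ := hbdd
  have hsol : ∀ s ∈ Set.Icc 0 b, (Ψ s).fn = IsUnitaryGroup.mild (unitaryGroup (hamiltonian γ))
      ψ₀.fn (fun r => (Complex.I * l) • nonlinearity μ (Ψ r).fn) s := by
    intro s hs
    rw [heq s hs, hψ.duhamel s (hb hs), IsUnitaryGroup.mild, ← intervalIntegral.integral_smul]
    congr 1
    refine intervalIntegral.integral_congr fun r hr => ?_
    rw [Set.uIcc_of_le hs.1] at hr
    rw [map_smul, heq r ⟨hr.1, hr.2.trans hs.2⟩]
  have hN : Continuous fun s => (Complex.I * l) • nonlinearity μ (Ψ s).fn :=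
    (continuous_const_smul (Complex.I * (l : ℂ))).comp ((Q.continuous_nonlinearity hμ).comp hΨ)
  have htI : t ∈ Set.Icc 0 b := ⟨ht0, htb.le⟩
  have h0I : (0 : ℝ) ∈ Set.Icc 0 b := ⟨le_rfl, hb0⟩
  constructor
  · rw [← heq t htI, hsol t htI]
    refine hU.norm_mild hN ψ₀.fn ht0 fun s hs => ?_
    rw [← hsol s ⟨hs.1, hs.2.trans htb.le⟩, inner_smul_right, Complex.mul_re, Complex.mul_im,
      Q.im_inner_nonlinearity hμ]
    simp
  · have := energy_eq_of_mild hγ hl hμ hU hΨ hsol (fun s => (hM s).1) (fun s => (hM s).2) ht0 htb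
    rwa [heq t htI, heq 0 h0I, hψ.initial (hb h0I)] at this

/-- With the convention `U = 0` for an operator which generates no unitary group, only the zero
solution exists. -/
theorem IsSolution.eq_initial_of_not_exists {T : EReal} {ψ₀ : Q} {ψ : ℝ → Q}
    (hψ : IsSolution γ l μ T ψ₀ ψ) (h : ¬∃ U, IsUnitaryGroup (hamiltonian γ) U)
    {t : ℝ} (ht : t ∈ timeInterval T) : ψ t = ψ₀ := by
  have h0 : (0 : ℝ) ∈ timeInterval T :=
    ⟨le_rfl, (EReal.coe_le_coe_iff.mpr ht.1).trans_lt ht.2⟩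
  have hz : ∀ s ∈ timeInterval T, (ψ s).fn = 0 := fun s hs => by
    rw [hψ.duhamel s hs, unitaryGroup, dif_neg h]
    simp
  rw [← hψ.initial h0]
  exact Q.ext_fn ((hz t ht).trans (hz 0 h0).symm)

end DeltaPrime

end

theorem proposition3p4 (γ l μ : ℝ) (hγ : 0 < γ) (hl : 0 < l) (hμ : 0 < μ)
    (T : EReal) (ψ₀ : DeltaPrime.Q) (ψ : ℝ → DeltaPrime.Q)
    (hψ : DeltaPrime.IsSolution γ l μ T ψ₀ ψ) :
    ∀ t ∈ DeltaPrime.timeInterval T,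
      ‖(ψ t).fn‖ = ‖ψ₀.fn‖ ∧
      DeltaPrime.energy γ l μ (ψ t) = DeltaPrime.energy γ l μ ψ₀ := by
  intro t ht
  by_cases h : ∃ U, DeltaPrime.IsUnitaryGroup (DeltaPrime.hamiltonian γ) U
  · exact hψ.conservation hγ hl hμ (DeltaPrime.isUnitaryGroup_unitaryGroup h) ht
  · rw [hψ.eq_initial_of_not_exists h ht]
    exact ⟨rfl, rfl⟩
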